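/- Let $K$ be a field of characteristic zero, $n\ge 2$, $d\ge 2$, $S=K[x_0,\dots,x_n]$ with $\mathbf m=(x_0,\dots,x_n)$, and let $V:f=0$ be a hypersurface in $\mathbb P^n$ defined by a homogeneous polynomial $f\in S$ of degree $d$. Let $J_f=(\partial f/\partial x_0,\dots,\partial f/\partial x_n)$, $M(f)=S/J_f$, and let $I=(J_f:\mathbf m^\infty)$ be the saturation of $J_f$. Assume that $V$ has isolated singularities, in the sense that $\dim S/J_f=1$, and that its singular scheme is a complete intersection of type $(a_1,\dots,a_n)$, i.e. $I=(g_1,\dots,g_n)$ for a regular sequence $g_1,\dots,g_n$ of homogeneous polynomials with $\deg g_i=a_i$. Let $\tau(V)$ be the total Tjurina number of $V$, i.e. the sum over the singular points $p$ of $V$ of the $K$-dimensions of the Tjurina algebras of $V$ at $p$ (the quotient of the local ring of $\mathbb P^n$ at $p$ by a local equation of $V$ and its first partial derivatives). Let $$st(V)=\min\{p\ge 0:\dim_K M(f)_k=\tau(V)\text{ for all }k\ge p\},$$ $$ct(V)=\max\{q\ge 0:\dim_K M(f)_k=\dim_K M(f_s)_k\text{ for all }k\le q\},$$ where $f_s\in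 S$ is any homogeneous polynomial of degree $d$ such that $f_s=0$ is a smooth hypersurface in $\mathbb P^n$. Then, with $T=(n+1)(d-2)$, $$\tau(V)=a_1a_2\cdots a_n,\qquad ct(V)=T-\sum_{i=1}^n a_i+n,\qquad st(V)=(n+1)(d-2)+1-\min_i a_i .$$ Moreover, the Hilbert series of $S/J_f$ and $S/I$ can be written as $H_{S/J_f}(t)=G(t)/(1-t)$ and $H_{S/I}(t)=F(t)/(1-t)$ with $G,F\in\mathbb Z[t]$, $G(1)\ne 0$, $F(1)\ne 0$, and $\deg G\ge\deg F$. -/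

import Mathlib

/-! Milnor algebras, singular loci and Tjurina numbers of projective hypersurfaces `V : f = 0` in
`ℙⁿ` over a field `K`, where `f` is a form in the variables `x_0, …, x_n`. -/

noncomputable section

namespace ProjHypersurface

open MvPolynomial

attribute [local instance] MvPolynomial.gradedAlgebra

variable {K : Type*} [Field K] {n : ℕ}

/-- The Jacobian ideal `J_f`, generated by the partial derivatives of `f`. -/
def jacobianIdeal (f : MvPolynomial (Fin (n + 1)) K) : Ideal (MvPolynomial (Fin (n + 1)) K) :=
  Ideal.span (Set.range fun j => pderiv j f)

/-- The saturation `(J : 𝔪^∞) = ⋃ₖ (J : 𝔪ᵏ)` of an ideal `J`, where `𝔪 = (x_0, …, x_n)`. -/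
def saturation (J : Ideal (MvPolynomial (Fin (n + 1)) K)) :
    Ideal (MvPolynomial (Fin (n + 1)) K) :=
  ⨆ k : ℕ, Submodule.colon J
    ((Ideal.span (Set.range fun j => (X j : MvPolynomial (Fin (n + 1)) K)) ^ k :
      Ideal (MvPolynomial (Fin (n + 1)) K)) : Set (MvPolynomial (Fin (n + 1)) K))

/-- The image in `S/J` of the space of forms of degree `k`; for a homogeneous ideal `J` this is
the degree `k` component `(S/J)_k`. -/
def gradedPiece (J : Ideal (MvPolynomial (Fin (n + 1)) K)) (k : ℕ) :
    Submodule K (MvPolynomial (Fin (n + 1)) K ⧸ J) :=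
  (homogeneousSubmodule (Fin (n + 1)) K k).map (Ideal.Quotient.mkₐ K J).toLinearMap

/-- The Hilbert function `k ↦ dim_K (S/J)_k`. -/
def hilbertFunction (J : Ideal (MvPolynomial (Fin (n + 1)) K)) (k : ℕ) : ℕ :=
  Module.finrank K (gradedPiece J k)

/-- The Hilbert series of `S/J`. -/
def hilbertSeries (J : Ideal (MvPolynomial (Fin (n + 1)) K)) : PowerSeries ℤ :=
  PowerSeries.mk fun k => (hilbertFunction J k : ℤ)

/-- `G ∈ ℤ[t]` is the numerator of the Hilbert series of the one-dimensional algebra `S/J`: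
`H_{S/J}(t) = G(t) / (1 - t)` and `G(1) ≠ 0`. -/
def IsHilbertNumerator (J : Ideal (MvPolynomial (Fin (n + 1)) K)) (G : Polynomial ℤ) : Prop :=
  hilbertSeries J * (1 - PowerSeries.X) = (G : PowerSeries ℤ) ∧ G.eval 1 ≠ 0

/-- The points of the scheme `ℙⁿ = Proj K[x_0, …, x_n]`. -/
abbrev Point (K : Type*) [Field K] (n : ℕ) :=
  ProjectiveSpectrum (homogeneousSubmodule (Fin (n + 1)) K)

/-- The local ring of `ℙⁿ` at a point `p`: fractions `a / s` with `a`, `s` forms of the same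
degree and `s ∉ p`. -/
abbrev LocalRing (p : Point K n) :=
  HomogeneousLocalization.AtPrime (homogeneousSubmodule (Fin (n + 1)) K)
    p.asHomogeneousIdeal.toIdeal

instance (p : Point K n) : Algebra K (LocalRing p) where
  algebraMap := (algebraMap (homogeneousSubmodule (Fin (n + 1)) K 0) (LocalRing p)).comp
    (algebraMap K (homogeneousSubmodule (Fin (n + 1)) K 0))
  commutes' _ _ := mul_comm _ _
  smul_def' c x := by
    apply HomogeneousLocalization.val_injective
    rw [HomogeneousLocalization.val_smul, HomogeneousLocalization.val_mul]
    change _ = Localization.mk (MvPolynomial.C c) 1 * _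
    rw [Localization.mk_one_eq_algebraMap, ← Algebra.smul_def, ← MvPolynomial.algebraMap_eq,
      algebraMap_smul]

/-- The singular points of `V : f = 0`, i.e. the points of `ℙⁿ` at which `f` and all its partial
derivatives vanish. -/
def singularLocus (f : MvPolynomial (Fin (n + 1)) K) : Set (Point K n) :=
  {p | f ∈ p.asHomogeneousIdeal ∧ ∀ j, pderiv j f ∈ p.asHomogeneousIdeal}

/-- The Tjurina ideal of `V : f = 0` at `p`, generated in the local ring of `ℙⁿ` at `p` by the
fractions `f / s` and `(∂f/∂x_j) / s`. In a chart `x_i ≠ 0` around `p`, with affine coordinates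
`y_j = x_j / x_i`, the local equation of `V` is `g = f / x_i ^ d`, and `∂g/∂y_j` is
`(∂f/∂x_j) / x_i ^ (d - 1)` for `j ≠ i`; by the Euler relation the fraction with `j = i` lies in
the ideal `(g, ∂g/∂y_j)` whenever `d` is the degree of `f`. -/
def tjurinaIdeal (f : MvPolynomial (Fin (n + 1)) K) (p : Point K n) : Ideal (LocalRing p) :=
  Ideal.span {q | ∃ c : HomogeneousLocalization.NumDenSameDeg
      (homogeneousSubmodule (Fin (n + 1)) K) p.asHomogeneousIdeal.toIdeal.primeCompl,
    ((c.num : MvPolynomial (Fin (n + 1)) K) = f ∨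
      ∃ j, (c.num : MvPolynomial (Fin (n + 1)) K) = pderiv j f) ∧
    q = HomogeneousLocalization.mk c}

/-- The local Tjurina number `τ(V, p)`: the dimension over `K` of the Tjurina algebra at `p`
(`⊤` if infinite). -/
def localTjurina (f : MvPolynomial (Fin (n + 1)) K) (p : Point K n) : ℕ∞ :=
  Module.length K (LocalRing p ⧸ tjurinaIdeal f p)

/-- The total Tjurina number `τ(V)`: the sum of the local Tjurina numbers over all singular points
(`⊤` if infinite). -/
def totalTjurina (f : MvPolynomial (Fin (n + 1)) K) : ℕ∞ :=
  ∑' p : singularLocus f, localTjurina f p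

/-- `V : f = 0` has stability threshold `st`: the least `p` such that
`dim_K M(f)_k = τ(V)` for all `k ≥ p`. -/
def IsStabilityThreshold (f : MvPolynomial (Fin (n + 1)) K) (st : ℕ) : Prop :=
  IsLeast {p : ℕ | ∀ k, p ≤ k → (hilbertFunction (jacobianIdeal f) k : ℕ∞) = totalTjurina f} st

/-- The degree `d` hypersurface `V : f = 0` has coincidence threshold `ct`: smooth hypersurfaces
`fs = 0` of degree `d` exist, and for each of them `ct` is the greatest `q` such that
`dim_K M(f)_k = dim_K M(fs)_k` for all `k ≤ q`. -/
def IsCoincidenceThreshold (d : ℕ) (f : MvPolynomial (Fin (n + 1)) K) (ct : ℕ) : Prop :=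
  (∃ fs : MvPolynomial (Fin (n + 1)) K, fs.IsHomogeneous d ∧ singularLocus fs = ∅) ∧
  ∀ fs : MvPolynomial (Fin (n + 1)) K, fs.IsHomogeneous d → singularLocus fs = ∅ →
    IsGreatest {q : ℕ | ∀ k, k ≤ q →
      hilbertFunction (jacobianIdeal f) k = hilbertFunction (jacobianIdeal fs) k} ct

end ProjHypersurface

end

/-! Write `e = d - 1`, let `𝔪` be the irrelevant ideal, and let `V` be the span of the partial
derivatives: forms of degree `e`, of dimension at most `n + 1`, with `𝔪 ^ N * I ⊆ J = (V) ⊆ I` for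
some `N`.

The core is a linkage argument. By `exists_exchange`, the `g_i` can be replaced one at a time by
general elements `c_i` of `V`, so that the sequence stays regular in every order, its ideal stays
saturated, and a form `M` of degree `D = n e - ∑ a_i` is carried along with `(c) : M = I` and `(c) :
I = (c, M)`. Classically `M` is the determinant of the transition matrix from `g` to `c`; here it is
built by one division per exchange, with no determinants and no unmixedness theorem. Now `J = (c,
w)` for one more `w ∈ V`, and saturatedness of `(c)` gives `(c) : w = (c) : J = (c) : I = (c, M)`.
The exact sequences for multiplication by `w` and by `M` on `S/(c)` yield `H_{S/J} = (1 - t^e)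
H_{S/(c)} + t^(e+D) H_{S/I}` (`hilbertSeries_mul_of_saturation`). The first summand is `((1 -
t^e)/(1 - t))^(n+1)`, the Hilbert series of a smooth Milnor algebra, by the same exchange started
from the variables. Since `H_{S/I}` begins with `1`, the two Milnor algebras first differ in degree
`e + D`, which gives `ct`.

For `st`, the Hilbert function attached to `G/(1 - t)` consists of the partial sums of the
coefficients of `G`, so it becomes constant, with value `G(1) = ∏ a_i`, exactly at `deg G`. This
degree is read off from the lowest term of the reversed polynomial of `(1 - t)^n G`
(`natDegree_almostCompleteIntersectionNumerator`).

For `τ`, a general linear form `l` is a nonzerodivisor on `S/I` and vanishes at no singular point.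
The coordinate ring of the singular scheme in the chart `l ≠ 0` has dimension the eventual value `∏
a_i` of the Hilbert function of `S/I`, and it is the product of the Tjurina algebras
(`totalTjurina_eq`). -/

noncomputable section

namespace ProjHypersurface

/-! ### Regular sequences, links and the exchange of one generator -/

section CommutativeAlgebra

variable {R : Type*} [CommRing R] {ι : Type*}

/-- `c` is a nonzerodivisor on `R ⧸ Q`. -/
def IsRegularMod (Q : Ideal R) (c : R) : Prop := ∀ x, c * x ∈ Q → x ∈ Q

/-- In `R ⧸ Q` congruences become equations, so the exchange arguments below reduce to linear
combinations followed by cancelling a nonzerodivisor. -/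
lemma isRegularMod_iff_mk {Q : Ideal R} {c : R} :
    IsRegularMod Q c ↔ ∀ x : R ⧸ Q, Ideal.Quotient.mk Q c * x = 0 → x = 0 := by
  constructor
  · intro h x hx
    obtain ⟨x, rfl⟩ := Ideal.Quotient.mk_surjective x
    rw [← map_mul, Ideal.Quotient.eq_zero_iff_mem] at hx
    exact Ideal.Quotient.eq_zero_iff_mem.2 (h x hx)
  · intro h x hx
    rw [← Ideal.Quotient.eq_zero_iff_mem] at hx ⊢
    exact h _ (by rw [← map_mul, hx])

lemma mem_sup_span_singleton_iff_mk {Q : Ideal R} {c x : R} :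
    x ∈ Q ⊔ Ideal.span {c} ↔
      ∃ u, Ideal.Quotient.mk Q x = Ideal.Quotient.mk Q c * Ideal.Quotient.mk Q u := by
  simp only [Submodule.mem_sup, Ideal.mem_span_singleton']
  constructor
  · rintro ⟨q, hq, _, ⟨u, rfl⟩, rfl⟩
    refine ⟨u, ?_⟩
    rw [map_add, Ideal.Quotient.eq_zero_iff_mem.2 hq, map_mul, zero_add, mul_comm]
  · rintro ⟨u, hu⟩
    rw [← map_mul, Ideal.Quotient.eq] at hu
    exact ⟨_, hu, _, ⟨u, rfl⟩, by ring⟩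

/-- If `b x = c u` modulo `Q`, regularity of `c` modulo `(Q, b)` gives `u = b v`, and cancelling `b`
leaves `x = c v`. -/
lemma IsRegularMod.swap {Q : Ideal R} {b c : R} (hb : IsRegularMod Q b)
    (hc : IsRegularMod (Q ⊔ Ideal.span {b}) c) : IsRegularMod (Q ⊔ Ideal.span {c}) b := by
  intro x hx
  rw [isRegularMod_iff_mk] at hb
  rw [mem_sup_span_singleton_iff_mk] at hx ⊢
  obtain ⟨u, hu⟩ := hx
  have := hc u (mem_sup_span_singleton_iff_mk.2 ⟨x, by rw [map_mul, ← hu, map_mul]⟩)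
  obtain ⟨v, hv⟩ := mem_sup_span_singleton_iff_mk.1 this
  refine ⟨v, ?_⟩
  rw [← sub_eq_zero]
  apply hb
  rw [map_mul] at hu
  linear_combination hu + Ideal.Quotient.mk Q c * hv

/-- A family that is a regular sequence in every order. -/
def IsPermRegular (y : ι → R) : Prop :=
  ∀ (T : Set ι) (i : ι), i ∉ T → IsRegularMod (Ideal.span (y '' T)) (y i)

lemma span_image_insert (y : ι → R) (T : Set ι) (i : ι) :
    Ideal.span (y '' insert i T) = Ideal.span (y '' T) ⊔ Ideal.span {y i} := by
  rw [Set.image_insert_eq, Ideal.span_insert, sup_comm]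

/-- The only new conditions involve `y j` modulo an ideal containing `c`; `IsRegularMod.swap` trades
them for regularity of `c` modulo an ideal generated by old elements. -/
lemma IsPermRegular.update [DecidableEq ι] {y : ι → R} (h : IsPermRegular y) {i : ι} {c : R}
    (hc : ∀ T : Set ι, i ∉ T → IsRegularMod (Ideal.span (y '' T)) c) :
    IsPermRegular (Function.update y i c) := by
  have key : ∀ T : Set ι, i ∉ T → Function.update y i c '' T = y '' T := fun T hT =>
    Set.image_congr fun j hj => Function.update_of_ne (by rintro rfl; exact hT hj) _ _
  intro T j hj
  by_cases hi : i ∈ T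
  · have hji : j ≠ i := fun h => hj (h ▸ hi)
    have hT : T = insert i (T \ {i}) := by simp [Set.insert_eq_of_mem hi]
    have hn : i ∉ T \ {i} := by simp
    rw [hT, span_image_insert, key _ hn, Function.update_self, Function.update_of_ne hji]
    refine (h _ _ fun h' => hj h'.1).swap ?_
    rw [← span_image_insert]
    exact hc _ (by simp [Ne.symm hji])
  · rw [key T hi]
    rcases eq_or_ne j i with rfl | hji
    · rw [Function.update_self]
      exact hc T hi
    · rw [Function.update_of_ne hji]
      exact h T j hj

/-- `P : M = I` and `P : I = P + (M)`, as for complete intersections `P ⊆ I` of the same height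
and the determinant `M` of a matrix expressing generators of `P` in terms of those of `I`. -/
structure IsLink (P I : Ideal R) (M : R) : Prop where
  mul_mem_iff : ∀ x, M * x ∈ P ↔ x ∈ I
  mem_of_colon : ∀ u, (∀ j ∈ I, u * j ∈ P) → u ∈ P ⊔ Ideal.span {M}

lemma IsLink.refl (I : Ideal R) : IsLink I I 1 where
  mul_mem_iff x := by rw [one_mul]
  mem_of_colon u _ := by
    rw [Ideal.span_singleton_one, sup_top_eq]
    trivial

/-- Modulo `Q` one has `M c = D g`, so `M x = g u` and `D x = c u` are equivalent, with the same
`u`: multiply by `c` or `g` and cancel the other. For the second colon, `x I ⊆ (Q, c)` and `g ∈ I`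
give `x g = c u`; then `u I ⊆ (Q, g)`, so `u = g α + M β`, and cancelling `g` in `x g = c g α + D g
β` yields `x = c α + D β`. -/
lemma IsLink.exchange {Q I : Ideal R} {g c M D : R} (hg : IsRegularMod Q g)
    (hc : IsRegularMod Q c) (hgI : g ∈ I) (h : IsLink (Q ⊔ Ideal.span {g}) I M)
    (hD : M * c - D * g ∈ Q) : IsLink (Q ⊔ Ideal.span {c}) I D := by
  rw [isRegularMod_iff_mk] at hg hc
  rw [← Ideal.Quotient.eq, map_mul, map_mul] at hD
  constructor
  · intro x
    rw [← h.mul_mem_iff, mem_sup_span_singleton_iff_mk, mem_sup_span_singleton_iff_mk]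
    refine exists_congr fun u => ?_
    simp only [map_mul]
    constructor
    · intro hu
      rw [← sub_eq_zero]
      apply hc
      linear_combination Ideal.Quotient.mk Q x * hD + Ideal.Quotient.mk Q g * hu
    · intro hu
      rw [← sub_eq_zero]
      apply hg
      linear_combination -Ideal.Quotient.mk Q x * hD + Ideal.Quotient.mk Q c * hu
  · intro x hx
    obtain ⟨u, hu⟩ := mem_sup_span_singleton_iff_mk.1 (hx g hgI)
    have hu' : u ∈ Q ⊔ Ideal.span {g} ⊔ Ideal.span {M} := by
      refine h.mem_of_colon u fun j hj => ?_
      obtain ⟨v, hv⟩ := mem_sup_span_singleton_iff_mk.1 (hx j hj)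
      refine mem_sup_span_singleton_iff_mk.2 ⟨v, ?_⟩
      rw [← sub_eq_zero]
      apply hc
      rw [map_mul] at *
      linear_combination -Ideal.Quotient.mk Q j * hu + Ideal.Quotient.mk Q g * hv
    rw [Submodule.mem_sup] at hu'
    obtain ⟨p, hp, q, hq, rfl⟩ := hu'
    obtain ⟨α, hα⟩ := mem_sup_span_singleton_iff_mk.1 hp
    obtain ⟨β, rfl⟩ := Ideal.mem_span_singleton'.1 hq
    rw [sup_assoc, ← Ideal.span_insert, ← Ideal.Quotient.eq_zero_iff_mem] at *
    have : Ideal.Quotient.mk Q (x - c * α - D * β) = 0 := by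
      apply hg
      simp only [map_mul, map_sub, map_add] at *
      linear_combination hu + Ideal.Quotient.mk Q c * hα + Ideal.Quotient.mk Q β * hD
    rw [Ideal.Quotient.eq_zero_iff_mem] at this ⊢
    have h1 : c * α + D * β ∈ Ideal.span {c, D} := Ideal.mem_span_pair.2 ⟨α, β, by ring⟩
    have := Submodule.add_mem_sup this h1
    rwa [show x - c * α - D * β + (c * α + D * β) = x by ring] at this

/-- `(P : 𝔪) = P`. -/
def IsSaturatedBy (𝔪 P : Ideal R) : Prop := ∀ x, (∀ z ∈ 𝔪, x * z ∈ P) → x ∈ P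

lemma IsSaturatedBy.pow {𝔪 P : Ideal R} (h : IsSaturatedBy 𝔪 P) (N : ℕ) :
    IsSaturatedBy (𝔪 ^ N) P := by
  induction N with
  | zero =>
    intro x hx
    simpa using hx 1 (by simp)
  | succ N ih =>
    intro x hx
    refine ih x fun z hz => h _ fun w hw => ?_
    rw [mul_assoc]
    exact hx _ (by rw [pow_succ]; exact Ideal.mul_mem_mul hz hw)

/-- The same division as for links, with `𝔪` in the role of `I`: write `x g = c u`, show `u 𝔪 ⊆ (Q,
g)`, hence `u = g α` and `x = c α` modulo `Q`. -/
lemma IsSaturatedBy.exchange {𝔪 Q : Ideal R} {g c : R} (hg : IsRegularMod Q g)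
    (hc : IsRegularMod Q c) (hgm : g ∈ 𝔪) (h : IsSaturatedBy 𝔪 (Q ⊔ Ideal.span {g})) :
    IsSaturatedBy 𝔪 (Q ⊔ Ideal.span {c}) := by
  rw [isRegularMod_iff_mk] at hg hc
  intro x hx
  obtain ⟨u, hu⟩ := mem_sup_span_singleton_iff_mk.1 (hx g hgm)
  have hu' : u ∈ Q ⊔ Ideal.span {g} := by
    refine h u fun j hj => ?_
    obtain ⟨v, hv⟩ := mem_sup_span_singleton_iff_mk.1 (hx j hj)
    refine mem_sup_span_singleton_iff_mk.2 ⟨v, ?_⟩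
    rw [← sub_eq_zero]
    apply hc
    rw [map_mul] at *
    linear_combination -Ideal.Quotient.mk Q j * hu + Ideal.Quotient.mk Q g * hv
  obtain ⟨α, hα⟩ := mem_sup_span_singleton_iff_mk.1 hu'
  refine mem_sup_span_singleton_iff_mk.2 ⟨α, ?_⟩
  rw [← sub_eq_zero]
  apply hg
  rw [map_mul] at *
  linear_combination hu + Ideal.Quotient.mk Q c * hα

end CommutativeAlgebra

/-! ### Prime avoidance over an infinite field -/

section Avoidance

variable {K R : Type*} [Field K] [Infinite K] [CommRing R] [Algebra K R]

/-- A subspace not contained in any associated prime of any of finitely many quotients `R ⧸ Q i`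
contains an element that is a nonzerodivisor on all of them. -/
lemma exists_isRegularMod [IsNoetherianRing R] {α : Type*} [Finite α] (Q : α → Ideal R)
    (V : Submodule K R)
    (hV : ∀ a, ∀ P : Ideal R, P.IsPrime → ∀ x, x ∉ Q a → (∀ z, z ∈ P ↔ x * z ∈ Q a) →
      ¬ (V : Set R) ⊆ P) :
    ∃ v ∈ V, ∀ a, IsRegularMod (Q a) v := by
  classical
  have hfin : (⋃ a, associatedPrimes R (R ⧸ Q a)).Finite :=
    Set.finite_iUnion fun a => associatedPrimes.finite R _
  let s : Finset (Submodule K V) :=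
    hfin.toFinset.image fun P => (P.restrictScalars K).comap V.subtype
  have hs : ⊤ ∉ s := by
    intro h
    obtain ⟨P, hP, hPV⟩ := Finset.mem_image.1 h
    simp only [Set.Finite.mem_toFinset, Set.mem_iUnion] at hP
    obtain ⟨a, ha⟩ := hP
    obtain ⟨hp, x, hx⟩ := isAssociatedPrime_iff.1 ha
    obtain ⟨x, rfl⟩ := Ideal.Quotient.mk_surjective x
    have hmem : ∀ z, z ∈ P ↔ x * z ∈ Q a := by
      intro z
      rw [hx, Submodule.mem_colon_singleton, Submodule.mem_bot, ← Ideal.Quotient.eq_zero_iff_mem,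
        mul_comm x, map_mul]
      rfl
    refine hV a P hp x ?_ hmem ?_
    · intro hxa
      exact hp.ne_top ((Ideal.eq_top_iff_one _).2 ((hmem 1).2 (by simpa using hxa)))
    · intro v hv
      have : (⟨v, hv⟩ : V) ∈ (P.restrictScalars K).comap V.subtype := hPV ▸ trivial
      exact this
  -- A vector space over an infinite field is not a finite union of proper subspaces, here the
  -- traces on `V` of the finitely many associated primes.
  have := Subspace.biUnion_ne_univ_of_top_notMem hs
  obtain ⟨v, hv⟩ := (Set.ne_univ_iff_exists_notMem _).1 this
  refine ⟨v, v.2, fun a x hx => ?_⟩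
  by_contra hxa
  obtain ⟨P, hP, hle⟩ := exists_le_isAssociatedPrime_of_isNoetherianRing R
    (Ideal.Quotient.mk (Q a) x) (by rwa [Ne, Ideal.Quotient.eq_zero_iff_mem])
  apply hv
  simp only [Set.mem_iUnion]
  refine ⟨_, Finset.mem_image.2 ⟨P, ?_, rfl⟩, ?_⟩
  · simp only [Set.Finite.mem_toFinset, Set.mem_iUnion]
    exact ⟨a, hP⟩
  · apply hle
    rw [Submodule.mem_colon_singleton, Submodule.mem_bot]
    exact Ideal.Quotient.eq_zero_iff_mem.2 hx

end Avoidance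

/-! ### Numerators of Hilbert series and their degrees -/

section Numerator

open Polynomial

variable {ι : Type*}

lemma natDegree_prod_one_sub_X_pow_le (a : ι → ℕ) (s : Finset ι) :
    (∏ i ∈ s, (1 - X ^ a i : ℤ[X])).natDegree ≤ ∑ i ∈ s, a i :=
  (natDegree_prod_le _ _).trans (Finset.sum_le_sum fun i _ =>
    (natDegree_sub_le _ _).trans (by simp))

lemma reflect_one_sub_X_pow (k : ℕ) : reflect k (1 - X ^ k : ℤ[X]) = -(1 - X ^ k) := by
  have h := reflect_monomial (R := ℤ) k k
  have h2 := reflect_one (R := ℤ) k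
  rw [reflect_sub, h, h2, revAt_le le_rfl, Nat.sub_self, pow_zero]
  ring

lemma reflect_prod_one_sub_X_pow (a : ι → ℕ) (s : Finset ι) :
    reflect (∑ i ∈ s, a i) (∏ i ∈ s, (1 - X ^ a i : ℤ[X])) =
      (-1) ^ s.card * ∏ i ∈ s, (1 - X ^ a i) := by
  classical
  induction s using Finset.induction_on with
  | empty => simp
  | insert i s hi ih =>
    rw [Finset.prod_insert hi, Finset.sum_insert hi, Finset.card_insert_of_notMem hi,
      reflect_mul _ _ ((natDegree_sub_le _ _).trans (by simp))
        (natDegree_prod_one_sub_X_pow_le a s), ih, reflect_one_sub_X_pow]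
    ring

/-- Modulo `X ^ (m + 1)` only the factors with exponent exactly `m` matter, and their cross terms
have degree at least `2 m ≥ m + 1`. -/
lemma X_pow_dvd_prod_one_sub_X_pow_sub {m : ℕ} (hm : 0 < m) (a : ι → ℕ) (s : Finset ι)
    (ha : ∀ i ∈ s, m ≤ a i) :
    (X ^ (m + 1) : ℤ[X]) ∣
      ∏ i ∈ s, (1 - X ^ a i) - (1 - ((s.filter fun i => a i = m).card : ℤ[X]) * X ^ m) := by
  classical
  induction s using Finset.induction_on with
  | empty => simp
  | insert i s hi ih =>
    obtain ⟨q, hq⟩ := ih fun j hj => ha j (Finset.mem_insert_of_mem hj)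
    rw [sub_eq_iff_eq_add] at hq
    rw [Finset.prod_insert hi, hq, Finset.filter_insert]
    split_ifs with him
    · rw [Finset.card_insert_of_notMem (by simp [hi]), him]
      obtain ⟨k, rfl⟩ := Nat.exists_eq_add_of_lt hm
      refine ⟨(1 - X ^ (0 + k + 1)) * q +
        ((s.filter fun i => a i = 0 + k + 1).card : ℤ[X]) * X ^ k, ?_⟩
      push_cast
      ring
    · obtain ⟨k, hk⟩ := Nat.exists_eq_add_of_lt
        (lt_of_le_of_ne (ha i (Finset.mem_insert_self i s)) (Ne.symm him))
      refine ⟨(1 - X ^ a i) * q - X ^ k *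
        (1 - ((s.filter fun i => a i = m).card : ℤ[X]) * X ^ m), ?_⟩
      rw [hk]
      ring

lemma coeff_prod_one_sub_X_pow_of_le {m : ℕ} (hm : 0 < m) (a : ι → ℕ) (s : Finset ι)
    (ha : ∀ i ∈ s, m ≤ a i) {k : ℕ} (hk : k ≤ m) :
    (∏ i ∈ s, (1 - X ^ a i : ℤ[X])).coeff k = (if k = 0 then 1 else 0) -
      if k = m then ((s.filter fun i => a i = m).card : ℤ) else 0 := by
  have h := X_pow_dvd_iff.1 (X_pow_dvd_prod_one_sub_X_pow_sub hm a s ha) k (by omega)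
  rw [coeff_sub, sub_eq_zero] at h
  rw [h, coeff_sub, coeff_one, ← C_eq_natCast, coeff_C_mul_X_pow]

variable [Fintype ι]

/-- The numerator of the Hilbert series of a complete intersection of type `a` and dimension one. -/
def completeIntersectionNumerator (a : ι → ℕ) : ℤ[X] := ∏ i, ∑ j ∈ Finset.range (a i), X ^ j

/-- The numerator of the Hilbert series of an ideal generated by `card ι + 1` forms of degree `e`
whose saturation is a complete intersection of type `a`. -/
def almostCompleteIntersectionNumerator (a : ι → ℕ) (e D : ℕ) : ℤ[X] :=
  (1 - X) * (∑ j ∈ Finset.range e, X ^ j) ^ (Fintype.card ι + 1) +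
    X ^ (e + D) * completeIntersectionNumerator a

lemma one_sub_X_pow_mul_completeIntersectionNumerator (a : ι → ℕ) :
    (1 - X) ^ Fintype.card ι * completeIntersectionNumerator a = ∏ i, (1 - X ^ a i) := by
  rw [completeIntersectionNumerator, ← Finset.card_univ, ← Finset.prod_const,
    ← Finset.prod_mul_distrib]
  exact Finset.prod_congr rfl fun i _ => mul_neg_geom_sum X (a i)

lemma one_sub_X_pow_mul_almostCompleteIntersectionNumerator (a : ι → ℕ) (e D : ℕ) :
    (1 - X) ^ Fintype.card ι * almostCompleteIntersectionNumerator a e D =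
      (1 - X ^ e) ^ (Fintype.card ι + 1) + X ^ (e + D) * ∏ i, (1 - X ^ a i) := by
  rw [almostCompleteIntersectionNumerator, ← one_sub_X_pow_mul_completeIntersectionNumerator,
    ← mul_neg_geom_sum, mul_pow]
  ring

lemma eval_one_completeIntersectionNumerator (a : ι → ℕ) :
    (completeIntersectionNumerator a).eval 1 = ((∏ i, a i : ℕ) : ℤ) := by
  simp [completeIntersectionNumerator, eval_prod, eval_finsetSum]

lemma eval_one_almostCompleteIntersectionNumerator (a : ι → ℕ) (e D : ℕ) :
    (almostCompleteIntersectionNumerator a e D).eval 1 = ((∏ i, a i : ℕ) : ℤ) := by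
  rw [almostCompleteIntersectionNumerator, eval_add, eval_mul, eval_mul,
    eval_one_completeIntersectionNumerator]
  simp

lemma natDegree_one_sub_X : (1 - X : ℤ[X]).natDegree = 1 := by
  rw [← neg_sub, natDegree_neg]
  exact natDegree_X_sub_C 1

lemma one_sub_X_ne_zero : (1 - X : ℤ[X]) ≠ 0 := fun h => by
  have := natDegree_one_sub_X
  simp [h] at this

lemma natDegree_completeIntersectionNumerator_le (a : ι → ℕ)
    (h : completeIntersectionNumerator a ≠ 0) :
    (completeIntersectionNumerator a).natDegree + Fintype.card ι ≤ ∑ i, a i := by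
  have := natDegree_prod_one_sub_X_pow_le a Finset.univ
  rw [← one_sub_X_pow_mul_completeIntersectionNumerator,
    natDegree_mul (pow_ne_zero _ one_sub_X_ne_zero) h, natDegree_pow, natDegree_one_sub_X] at this
  omega

/-- With `r = card ι`, both summands of `(1 - X)^r G` are palindromic products up to sign, shifted
so that they end in degree `(r + 1) e`. Reversal turns the cancellation of top terms into the
cancellation of the lowest terms of `∏ (1 - X ^ a i) - (1 - X ^ e)^(r + 1)`, whose first nonzero
coefficient is in degree `m`. -/
lemma natDegree_almostCompleteIntersectionNumerator {a : ι → ℕ} {e D m : ℕ} (hm0 : 0 < m)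
    (hD : D + ∑ i, a i = Fintype.card ι * e) (hm : ∀ i, m ≤ a i) (hm' : ∃ i, a i = m) :
    (almostCompleteIntersectionNumerator a e D).natDegree + Fintype.card ι + m =
      (Fintype.card ι + 1) * e := by
  classical
  set r := Fintype.card ι with hr
  have hr0 : 0 < r := Fintype.card_pos_iff.2 ⟨hm'.choose⟩
  have hsum : r * m ≤ ∑ i, a i := by
    have := Finset.sum_le_sum fun i (_ : i ∈ Finset.univ) => hm i
    simpa [hr] using this
  have hme : m ≤ e := by
    by_contra! h
    have := Nat.mul_lt_mul_of_pos_left h hr0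
    omega
  set A : ℤ[X] := ∏ i, (1 - X ^ a i) with hA
  set B : ℤ[X] := (1 - X ^ e) ^ (r + 1) with hB
  have hBprod : B = ∏ i : Fin (r + 1), (1 - X ^ (fun _ => e : Fin (r + 1) → ℕ) i) := by simp [hB]
  have hsumB : ∑ i : Fin (r + 1), (fun _ => e : Fin (r + 1) → ℕ) i = (r + 1) * e := by simp
  have hL : (r + 1) * e = ∑ i, a i + (e + D) := by rw [add_mul, ← hD]; ring
  have hreflB : reflect ((r + 1) * e) B = (-1) ^ (r + 1) * B := by
    have := reflect_prod_one_sub_X_pow (fun _ => e : Fin (r + 1) → ℕ) Finset.univ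
    rwa [hsumB, ← hBprod, Finset.card_univ, Fintype.card_fin] at this
  have hreflA : reflect ((r + 1) * e) A = (-1) ^ r * (X ^ (e + D) * A) := by
    have := reflect_prod_one_sub_X_pow a Finset.univ
    have h2 := reflect_mul A 1 (F := ∑ i, a i) (G := e + D)
      (natDegree_prod_one_sub_X_pow_le a Finset.univ) (by simp)
    rw [mul_one, ← hL, this, reflect_one, Finset.card_univ] at h2
    rw [h2]
    ring
  set N : ℤ[X] := B + X ^ (e + D) * A with hN
  have hrefl : N = (-1) ^ r * reflect ((r + 1) * e) (A - B) := by
    rw [reflect_sub, hreflA, hreflB, hN]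
    have : ((-1 : ℤ[X]) ^ r) * (-1) ^ r = 1 := by rw [← mul_pow]; simp
    linear_combination (-X ^ (e + D) * A - B) * this
  have hcoeff : ∀ k, N.coeff k = (-1) ^ r * (A - B).coeff (revAt ((r + 1) * e) k) := by
    intro k
    rw [hrefl, ← coeff_reflect, show ((-1 : ℤ[X]) ^ r) = C ((-1) ^ r) by simp, coeff_C_mul]
  have hAc := fun {k} (hk : k ≤ m) =>
    coeff_prod_one_sub_X_pow_of_le hm0 a Finset.univ (fun i _ => hm i) hk
  have hBc := fun {k} (hk : k ≤ m) =>
    coeff_prod_one_sub_X_pow_of_le hm0 (fun _ => e : Fin (r + 1) → ℕ) Finset.univ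
      (fun i _ => hme) hk
  rw [← hBprod] at hBc
  have hmL : m ≤ (r + 1) * e := by nlinarith
  have hNdeg : N.natDegree = (r + 1) * e - m := by
    apply natDegree_eq_of_le_of_coeff_ne_zero
    · rw [natDegree_le_iff_coeff_eq_zero]
      intro k hk
      by_cases hkL : k ≤ (r + 1) * e
      · have hne : ¬ (r + 1) * e - k = m := by omega
        rw [hcoeff, revAt_le hkL, coeff_sub, hAc (by omega), hBc (by omega)]
        simp only [if_neg hne, sub_self, mul_zero]
      · apply coeff_eq_zero_of_natDegree_lt
        refine lt_of_le_of_lt (natDegree_add_le_of_degree_le (n := (r + 1) * e) ?_ ?_)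
          (not_le.1 hkL)
        · have := natDegree_prod_one_sub_X_pow_le (fun _ => e : Fin (r + 1) → ℕ) Finset.univ
          rwa [hsumB, ← hBprod] at this
        · refine natDegree_mul_le.trans ?_
          rw [natDegree_X_pow, hL, add_comm]
          exact Nat.add_le_add_right (natDegree_prod_one_sub_X_pow_le a Finset.univ) _
    · rw [hcoeff, revAt_le (by omega), Nat.sub_sub_self hmL, coeff_sub, hAc le_rfl, hBc le_rfl]
      refine mul_ne_zero (pow_ne_zero _ (by norm_num)) ?_
      simp only [if_true]
      have h1 : (Finset.univ.filter fun i => a i = m).card ≤ r := Finset.card_le_univ _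
      have h2 : 0 < (Finset.univ.filter fun i => a i = m).card :=
        Finset.card_pos.2 ⟨hm'.choose, by simp [hm'.choose_spec]⟩
      -- The coefficient is minus the number of `i` with `a i = m`, plus `r + 1` if `e = m`. That
      -- number lies between `1` and `r`, so the coefficient is nonzero in both cases.
      by_cases hem : e = m
      · simp only [hem, Finset.filter_true, Finset.card_univ, Fintype.card_fin]
        push_cast
        omega
      · simp only [hem, Finset.filter_false, Finset.card_empty]
        push_cast
        omega
  have hmul := one_sub_X_pow_mul_almostCompleteIntersectionNumerator a e D
  rw [← hr, ← hA, ← hB, ← hN] at hmul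
  have hG : almostCompleteIntersectionNumerator a e D ≠ 0 := by
    intro h
    have h1 := eval_one_almostCompleteIntersectionNumerator a e D
    rw [h, eval_zero] at h1
    have h2 : ∏ i, a i = 0 := by exact_mod_cast h1.symm
    obtain ⟨i, -, hi⟩ := Finset.prod_eq_zero_iff.1 h2
    have := hm i
    omega
  rw [← hmul, natDegree_mul (pow_ne_zero _ one_sub_X_ne_zero) hG, natDegree_pow,
    natDegree_one_sub_X] at hNdeg
  omega

lemma coeff_eq_sum_of_mul_one_sub_X {H : PowerSeries ℤ} {G : ℤ[X]}
    (h : H * (1 - PowerSeries.X) = (G : PowerSeries ℤ)) (k : ℕ) :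
    PowerSeries.coeff k H = ∑ j ∈ Finset.range (k + 1), G.coeff j := by
  induction k with
  | zero =>
    have := congrArg (PowerSeries.coeff 0) h
    rw [coeff_coe] at this
    rw [Finset.sum_range_one, ← this]
    simp [mul_sub]
  | succ k ih =>
    have := congrArg (PowerSeries.coeff (k + 1)) h
    rw [coeff_coe, mul_sub, mul_one, map_sub, PowerSeries.coeff_succ_mul_X] at this
    rw [Finset.sum_range_succ, ← ih, ← this]
    ring

lemma coeff_eq_eval_one_of_mul_one_sub_X {H : PowerSeries ℤ} {G : ℤ[X]}
    (h : H * (1 - PowerSeries.X) = (G : PowerSeries ℤ)) {k : ℕ} (hk : G.natDegree ≤ k) :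
    PowerSeries.coeff k H = G.eval 1 := by
  rw [coeff_eq_sum_of_mul_one_sub_X h, eval_eq_sum_range' (Nat.lt_succ_of_le hk)]
  simp

/-- The partial sum just before the degree of `G` misses exactly the leading coefficient. -/
lemma coeff_ne_eval_one_of_mul_one_sub_X {H : PowerSeries ℤ} {G : ℤ[X]}
    (h : H * (1 - PowerSeries.X) = (G : PowerSeries ℤ)) {k : ℕ} (hk : G.natDegree = k + 1) :
    PowerSeries.coeff k H ≠ G.eval 1 := by
  rw [← coeff_eq_eval_one_of_mul_one_sub_X h hk.le, coeff_eq_sum_of_mul_one_sub_X h,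
    coeff_eq_sum_of_mul_one_sub_X h, Finset.sum_range_succ _ (k + 1), ← hk, coeff_natDegree]
  have : G.leadingCoeff ≠ 0 := by
    rw [leadingCoeff_ne_zero]
    rintro rfl
    simp at hk
  simpa using this

lemma powerSeries_one_sub_X_ne_zero : (1 - PowerSeries.X : PowerSeries ℤ) ≠ 0 := fun h => by
  simpa using congrArg (PowerSeries.coeff 0) h

lemma mul_one_sub_X_eq_coe {H : PowerSeries ℤ} {G : ℤ[X]} {r : ℕ}
    (h : H * (1 - PowerSeries.X) ^ (r + 1) = (((1 - X) ^ r * G : ℤ[X]) : PowerSeries ℤ)) :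
    H * (1 - PowerSeries.X) = (G : PowerSeries ℤ) := by
  apply mul_left_cancel₀ (pow_ne_zero r powerSeries_one_sub_X_ne_zero)
  rw [coe_mul, coe_pow, coe_sub, coe_one, coe_X] at h
  linear_combination h

lemma coe_prod_one_sub_X_pow (a : ι → ℕ) :
    ((∏ i, (1 - X ^ a i) : ℤ[X]) : PowerSeries ℤ) = ∏ i, (1 - PowerSeries.X ^ a i) := by
  rw [← coeToPowerSeries.ringHom_apply, map_prod]
  simp

end Numerator

/-! ### Finite algebras as products of their localizations -/

section LengthSum

/-- A finite algebra `A ⧸ b` is the product of its localizations, which are quotients of the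
localizations of `A` at the primes containing `b`. -/
lemma tsum_length_quotient_map {K A : Type*} [Field K] [CommRing A] [Algebra K A] (b : Ideal A)
    [Module.Finite K (A ⧸ b)] {Θ : Type*} (P : Θ → Ideal A) [∀ θ, (P θ).IsPrime]
    (hbP : ∀ θ, b ≤ P θ) (hinj : Function.Injective P)
    (hsurj : ∀ Q : Ideal A, Q.IsPrime → b ≤ Q → ∃ θ, P θ = Q)
    (L : Θ → Type*) [∀ θ, CommRing (L θ)] [∀ θ, Algebra K (L θ)] [∀ θ, Algebra A (L θ)]
    [∀ θ, IsScalarTower K A (L θ)] [∀ θ, IsLocalization (P θ).primeCompl (L θ)] :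
    ∑' θ, Module.length K (L θ ⧸ b.map (algebraMap A (L θ))) = Module.finrank K (A ⧸ b) := by
  classical
  have : IsArtinianRing (A ⧸ b) := isArtinian_of_tower K inferInstance
  let q : Θ → PrimeSpectrum (A ⧸ b) := fun θ =>
    ⟨(P θ).map (Ideal.Quotient.mk b), Ideal.map_isPrime_of_surjective
      Ideal.Quotient.mk_surjective (by rw [Ideal.mk_ker]; exact hbP θ)⟩
  have hqprime : ∀ θ, (q θ).asIdeal.IsPrime := fun θ => (q θ).isPrime
  have hcomap : ∀ θ, (q θ).asIdeal.comap (Ideal.Quotient.mk b) = P θ := by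
    intro θ
    change Ideal.comap _ (Ideal.map _ _) = _
    rw [Ideal.comap_map_of_surjective _ Ideal.Quotient.mk_surjective, ← RingHom.ker_eq_comap_bot,
      Ideal.mk_ker, sup_eq_left]
    exact hbP θ
  have hq : Function.Bijective q := by
    constructor
    · intro θ₁ θ₂ h
      exact hinj (by rw [← hcomap, ← hcomap, h])
    · intro r
      obtain ⟨θ, hθ⟩ := hsurj (r.asIdeal.comap (Ideal.Quotient.mk b)) inferInstance (by
        intro x hx
        rw [Ideal.mem_comap, Ideal.Quotient.eq_zero_iff_mem.2 hx]
        exact Ideal.zero_mem _)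
      refine ⟨θ, PrimeSpectrum.ext ?_⟩
      change (P θ).map _ = _
      rw [hθ, Ideal.map_comap_of_surjective _ Ideal.Quotient.mk_surjective]
  have hlen : ∀ θ, Module.length K (L θ ⧸ b.map (algebraMap A (L θ))) =
      (Module.finrank K (Localization.AtPrime (q θ).asIdeal) : ℕ∞) := by
    intro θ
    have hsub : Algebra.algebraMapSubmonoid (A ⧸ b) (P θ).primeCompl =
        (q θ).asIdeal.primeCompl := by
      ext x
      obtain ⟨x, rfl⟩ := Ideal.Quotient.mk_surjective x
      have hx : x ∈ P θ ↔ Ideal.Quotient.mk b x ∈ (q θ).asIdeal := by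
        rw [← hcomap θ, Ideal.mem_comap]
      rw [Ideal.mem_primeCompl_iff, ← hx]
      constructor
      · rintro ⟨y, hy, hyx⟩ hxP
        have hyx' : Ideal.Quotient.mk b y = Ideal.Quotient.mk b x := hyx
        have : y ∈ P θ := by
          rw [← hcomap θ, Ideal.mem_comap, hyx', ← hx]
          exact hxP
        exact hy this
      · intro h
        exact ⟨x, h, rfl⟩
    have hloc : IsLocalization (Algebra.algebraMapSubmonoid (A ⧸ b) (P θ).primeCompl)
        (L θ ⧸ b.map (algebraMap A (L θ))) := inferInstance
    rw [hsub] at hloc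
    have : IsScalarTower K (A ⧸ b) (L θ ⧸ b.map (algebraMap A (L θ))) :=
      IsScalarTower.of_algebraMap_eq fun c => by
        change Ideal.Quotient.mk _ (algebraMap K (L θ) c) =
          Ideal.Quotient.mk _ (algebraMap A (L θ) (algebraMap K A c))
        rw [← IsScalarTower.algebraMap_apply]
    -- An Artinian ring surjects onto each of its localizations.
    have hfin : Module.Finite K (Localization.AtPrime (q θ).asIdeal) :=
      Module.Finite.of_surjective
        (Algebra.algHom K (A ⧸ b) (Localization.AtPrime (q θ).asIdeal)).toLinearMap
        (IsArtinianRing.localization_surjective (q θ).asIdeal.primeCompl _)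
    let E := ((IsLocalization.algEquiv (q θ).asIdeal.primeCompl
      (Localization.AtPrime (q θ).asIdeal)
      (L θ ⧸ b.map (algebraMap A (L θ)))).restrictScalars K).toLinearEquiv
    rw [← E.length_eq, Module.length_eq_finrank]
  have : Fintype (PrimeSpectrum (A ⧸ b)) := Fintype.ofFinite _
  refine (tsum_congr hlen).trans (((Equiv.ofBijective q hq).tsum_eq fun r =>
    (Module.finrank K (Localization.AtPrime r.asIdeal) : ℕ∞)).trans ?_)
  rw [IsArtinianRing.finrank_eq_sum_primeSpectrum (A ⧸ b) K, tsum_fintype, Nat.cast_sum]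

end LengthSum

open MvPolynomial

attribute [local instance] MvPolynomial.gradedAlgebra

/-! ### Homogeneous ideals and permutability of homogeneous regular sequences -/

section Homogeneous

variable {K : Type*} [Field K] {σ : Type*}

lemma coe_decompose_eq_homogeneousComponent (x : MvPolynomial σ K) (k : ℕ) :
    (DirectSum.decompose (homogeneousSubmodule σ K) x k : MvPolynomial σ K) =
      homogeneousComponent k x :=
  decomposition.decompose'_apply x k

lemma homogeneousComponent_mul_of_le {h : MvPolynomial σ K} {δ k : ℕ} (hh : h.IsHomogeneous δ)
    (x : MvPolynomial σ K) (hk : δ ≤ k) :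
    homogeneousComponent k (h * x) = h * homogeneousComponent (k - δ) x := by
  rw [← coe_decompose_eq_homogeneousComponent, ← coe_decompose_eq_homogeneousComponent]
  exact DirectSum.coe_decompose_mul_of_left_mem_of_le (homogeneousSubmodule σ K) hh hk

lemma homogeneousComponent_mul_of_lt {h : MvPolynomial σ K} {δ k : ℕ} (hh : h.IsHomogeneous δ)
    (x : MvPolynomial σ K) (hk : k < δ) :
    homogeneousComponent k (h * x) = 0 := by
  rw [← coe_decompose_eq_homogeneousComponent]
  exact DirectSum.coe_decompose_mul_of_left_mem_of_not_le (homogeneousSubmodule σ K) hh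
    (not_le.2 hk)

/-- An ideal of a polynomial ring that is homogeneous for the standard grading. -/
abbrev IsHomogeneousIdeal (Q : Ideal (MvPolynomial σ K)) : Prop :=
  Q.IsHomogeneous (homogeneousSubmodule σ K)

lemma isHomogeneousIdeal_span {s : Set (MvPolynomial σ K)} (hs : ∀ x ∈ s, ∃ k, x.IsHomogeneous k) :
    IsHomogeneousIdeal (Ideal.span s) :=
  Ideal.homogeneous_span _ _ hs

lemma isHomogeneousIdeal_span_image {ι : Type*} {y : ι → MvPolynomial σ K} {a : ι → ℕ}
    (hy : ∀ i, (y i).IsHomogeneous (a i)) (T : Set ι) :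
    IsHomogeneousIdeal (Ideal.span (y '' T)) :=
  isHomogeneousIdeal_span (by rintro _ ⟨i, _, rfl⟩; exact ⟨a i, hy i⟩)

lemma exists_isHomogeneous_of_mem_sup_span {Q : Ideal (MvPolynomial σ K)}
    (hQ : IsHomogeneousIdeal Q) {h x : MvPolynomial σ K} {δ k : ℕ} (hh : h.IsHomogeneous δ)
    (hx : x.IsHomogeneous k) (hxQ : x ∈ Q ⊔ Ideal.span {h}) :
    x ∈ Q ∨ δ ≤ k ∧ ∃ u : MvPolynomial σ K, u.IsHomogeneous (k - δ) ∧ x - h * u ∈ Q := by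
  obtain ⟨q, hq, z, hz, rfl⟩ := Submodule.mem_sup.1 hxQ
  obtain ⟨u, rfl⟩ := Ideal.mem_span_singleton.1 hz
  rcases lt_or_ge k δ with hk | hk
  · left
    rw [← homogeneousComponent_eq_self hx, map_add, homogeneousComponent_mul_of_lt hh u hk,
      add_zero]
    exact homogeneousComponent_mem_of_mem hQ hq k
  · refine Or.inr ⟨hk, homogeneousComponent (k - δ) u, homogeneousComponent_isHomogeneous _ _, ?_⟩
    rw [← homogeneousComponent_eq_self hx, map_add, homogeneousComponent_mul_of_le hh u hk,
      add_sub_cancel_right]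
    exact homogeneousComponent_mem_of_mem hQ hq k

lemma isPermRegular_X : IsPermRegular (X : σ → MvPolynomial σ K) := by
  intro T i hi x hx
  rw [mem_ideal_span_X_image] at hx ⊢
  intro m hm
  obtain ⟨j, hj, hmj⟩ := hx (Finsupp.single i 1 + m) (by
    rw [mem_support_iff] at hm ⊢
    rwa [coeff_X_mul])
  refine ⟨j, hj, ?_⟩
  have : i ≠ j := fun h => hi (h ▸ hj)
  simpa [this] using hmj

/-- Graded Nakayama: `L ⊆ Q + a L` with `deg a > 0` forces `L ⊆ Q`, by induction on the degree of a
form in `L`. -/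
lemma mem_of_isHomogeneous_of_forall_mem_sup {Q L : Ideal (MvPolynomial σ K)}
    (hQ : IsHomogeneousIdeal Q) (hL : IsHomogeneousIdeal L)
    {a : MvPolynomial σ K} {δ : ℕ} (ha : a.IsHomogeneous δ) (hδ : 0 < δ)
    (h : ∀ x ∈ L, ∃ u ∈ L, x - a * u ∈ Q) : L ≤ Q := by
  have key : ∀ k, ∀ x ∈ L, x.IsHomogeneous k → x ∈ Q := by
    intro k
    induction k using Nat.strong_induction_on with
    | _ k ih =>
      intro x hx hxk
      obtain ⟨u, hu, hxu⟩ := h x hx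
      have h1 := homogeneousComponent_mem_of_mem hQ hxu k
      rw [map_sub, homogeneousComponent_eq_self hxk] at h1
      rcases lt_or_ge k δ with hk | hk
      · rwa [homogeneousComponent_mul_of_lt ha u hk, sub_zero] at h1
      · rw [homogeneousComponent_mul_of_le ha u hk] at h1
        have := ih (k - δ) (by omega) _ (homogeneousComponent_mem_of_mem hL hu _)
          (homogeneousComponent_isHomogeneous _ _)
        simpa using Q.add_mem h1 (Q.mul_mem_left a this)
  intro x hx
  rw [mem_iff_homogeneousComponent_mem hQ]
  exact fun k => key k _ (homogeneousComponent_mem_of_mem hL hx k)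
    (homogeneousComponent_isHomogeneous _ _)

lemma isHomogeneousIdeal_colon {Q : Ideal (MvPolynomial σ K)}
    (hQ : IsHomogeneousIdeal Q) {b : MvPolynomial σ K} {δ : ℕ} (hb : b.IsHomogeneous δ)
    {L : Ideal (MvPolynomial σ K)} (hL : ∀ x, x ∈ L ↔ b * x ∈ Q) : IsHomogeneousIdeal L := by
  intro k x hx
  rw [coe_decompose_eq_homogeneousComponent, hL]
  have := homogeneousComponent_mem_of_mem hQ ((hL x).1 hx) (k + δ)
  rwa [homogeneousComponent_mul_of_le hb x (by omega), Nat.add_sub_cancel] at this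

-- Two neighbours `b, c` of a regular sequence may be swapped once the `c`-torsion `N` of the
-- quotient by the remaining elements involved satisfies `N = b N → N = 0`. The preimage of `N` is a
-- homogeneous colon ideal, so graded Nakayama applies.
open RingTheory.Sequence in
lemma isPermRegular_of_isRegular {r : ℕ} {y : Fin r → MvPolynomial σ K} {a : Fin r → ℕ}
    (hy : ∀ i, (y i).IsHomogeneous (a i)) (ha : ∀ i, 0 < a i)
    (hreg : IsWeaklyRegular (MvPolynomial σ K) (List.ofFn y)) : IsPermRegular y := by
  classical
  intro T i hi
  -- An ordering that lists `T` first and `i` next: weak regularity at that position is the required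
  -- statement.
  let l : List (Fin r) := T.toFinset.toList ++ i :: (insert i T.toFinset)ᶜ.toList
  have hl : (List.finRange r).Perm l := by
    refine (List.perm_ext_iff_of_nodup (List.nodup_finRange r) ?_).2 ?_
    · simp only [l, List.nodup_append, List.nodup_cons, Finset.nodup_toList, Finset.mem_toList,
        List.mem_cons]
      simp only [Set.mem_toFinset, Finset.mem_compl, Finset.mem_insert, true_or, not_true_eq_false,
        not_false_eq_true, and_true, true_and]
      rintro j hj k (rfl | hk) rfl
      · exact hi hj
      · exact hk (Or.inr hj)
    · intro j
      simp only [l, List.mem_append, List.mem_cons, Finset.mem_toList, Finset.mem_compl,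
        Finset.mem_insert, List.mem_finRange, true_iff]
      tauto
  have hperm : IsWeaklyRegular (MvPolynomial σ K) (l.map y) := by
    refine hreg.prototype_perm (by rw [List.ofFn_eq_map]; exact hl.map y) ?_
    intro b c rs hsub
    have hhom : ∀ x ∈ b :: c :: rs, ∃ k, 0 < k ∧ x.IsHomogeneous k := by
      intro x hx
      have := hsub.subset hx
      rw [List.mem_ofFn] at this
      obtain ⟨j, rfl⟩ := this
      exact ⟨a j, ha j, hy j⟩
    obtain ⟨δ, hδ, hbδ⟩ := hhom b (by simp)
    obtain ⟨ε, _, hcε⟩ := hhom c (by simp)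
    have hQ : IsHomogeneousIdeal (Ideal.ofList rs) :=
      isHomogeneousIdeal_span fun x hx =>
        (hhom x (List.mem_cons_of_mem _ (List.mem_cons_of_mem _ hx))).imp fun _ h => h.2
    intro N hN
    rw [eq_bot_iff]
    intro z hz
    obtain ⟨x, rfl⟩ := Submodule.mkQ_surjective _ z
    have hmem : ∀ x, x ∈ (Ideal.ofList rs • ⊤ : Submodule (MvPolynomial σ K) (MvPolynomial σ K)) ↔
        x ∈ Ideal.ofList rs := by
      intro x
      rw [smul_eq_mul, Ideal.mul_top]
    let L : Ideal (MvPolynomial σ K) := Submodule.comap (Submodule.mkQ _) N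
    have hL : ∀ x, x ∈ L ↔ c * x ∈ Ideal.ofList rs := by
      intro x
      rw [← hmem]
      simp only [L, N, Submodule.mem_comap, Submodule.mem_torsionBy_iff, ← map_smul, smul_eq_mul]
      rw [Submodule.mkQ_apply, Submodule.Quotient.mk_eq_zero]
    have hle : L ≤ Ideal.ofList rs := by
      refine mem_of_isHomogeneous_of_forall_mem_sup hQ (isHomogeneousIdeal_colon hQ hcε hL) hbδ hδ ?_
      intro x hx
      have hx' : Submodule.mkQ _ x ∈ N := hx
      rw [hN] at hx'
      obtain ⟨w, hw, hwx⟩ := Submodule.mem_smul_pointwise_iff_exists _ _ _ |>.1 hx'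
      obtain ⟨u, rfl⟩ := Submodule.mkQ_surjective _ w
      refine ⟨u, hw, ?_⟩
      rw [← hmem, ← Submodule.Quotient.mk_eq_zero, ← Submodule.mkQ_apply, map_sub, ← smul_eq_mul,
        map_smul, hwx, sub_self]
    rw [Submodule.mem_bot, Submodule.mkQ_apply, Submodule.Quotient.mk_eq_zero, hmem]
    exact hle hz
  rw [List.map_append, List.map_cons, isWeaklyRegular_append_iff, isWeaklyRegular_cons_iff] at hperm
  have h1 := hperm.2.1
  have hspan : Ideal.ofList (T.toFinset.toList.map y) = Ideal.span (y '' T) := by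
    change Ideal.span {x | x ∈ T.toFinset.toList.map y} = _
    congr 1
    ext x
    simp
  intro x hx
  have hmem : ∀ x, x ∈ (Ideal.ofList (T.toFinset.toList.map y) • ⊤ :
      Submodule (MvPolynomial σ K) (MvPolynomial σ K)) ↔ x ∈ Ideal.span (y '' T) := by
    intro x
    rw [smul_eq_mul, Ideal.mul_top, hspan]
  rw [← hmem, ← Submodule.Quotient.mk_eq_zero] at hx ⊢
  rw [← smul_eq_mul, Submodule.Quotient.mk_smul] at hx
  exact h1 (hx.trans (smul_zero _).symm)

end Homogeneous

/-! ### Hilbert series of complete intersections -/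

section Hilbert

variable {K : Type*} [Field K] {n : ℕ}

lemma finrank_map_add_finrank_inf_ker {V W : Type*} [AddCommGroup V] [Module K V]
    [AddCommGroup W] [Module K W] (f : V →ₗ[K] W) (p : Submodule K V) [FiniteDimensional K p] :
    Module.finrank K (p.map f) + Module.finrank K (p ⊓ LinearMap.ker f : Submodule K V) =
      Module.finrank K p := by
  rw [← LinearMap.finrank_range_add_finrank_ker (f.domRestrict p), LinearMap.range_domRestrict,
    LinearMap.ker_domRestrict, ← Submodule.map_comap_subtype, Submodule.finrank_map_subtype_eq]

instance (k : ℕ) : FiniteDimensional K (homogeneousSubmodule (Fin (n + 1)) K k) :=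
  Module.Finite.iff_fg.2 (homogeneousSubmodule_fg (Fin (n + 1)) K k)

lemma ker_mkₐ_toLinearMap (J : Ideal (MvPolynomial (Fin (n + 1)) K)) :
    LinearMap.ker (Ideal.Quotient.mkₐ K J).toLinearMap = J.restrictScalars K := by
  ext x
  simp [Ideal.Quotient.eq_zero_iff_mem]

lemma hilbertFunction_add_finrank (J : Ideal (MvPolynomial (Fin (n + 1)) K)) (k : ℕ) :
    hilbertFunction J k + Module.finrank K
      (homogeneousSubmodule (Fin (n + 1)) K k ⊓ J.restrictScalars K : Submodule K _) =
      Module.finrank K (homogeneousSubmodule (Fin (n + 1)) K k) := by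
  have h := finrank_map_add_finrank_inf_ker (Ideal.Quotient.mkₐ K J).toLinearMap
    (homogeneousSubmodule (Fin (n + 1)) K k)
  rwa [ker_mkₐ_toLinearMap] at h

lemma coeff_hilbertSeries (J : Ideal (MvPolynomial (Fin (n + 1)) K)) (k : ℕ) :
    PowerSeries.coeff k (hilbertSeries J) = hilbertFunction J k :=
  PowerSeries.coeff_mk _ _

/-- Additivity of Hilbert series along `0 → S/(Q : h)(-δ) → S/Q → S/(Q, h) → 0`. -/
lemma hilbertSeries_eq_add {Q Q' : Ideal (MvPolynomial (Fin (n + 1)) K)}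
    (hQ : IsHomogeneousIdeal Q) {h : MvPolynomial (Fin (n + 1)) K} {δ : ℕ}
    (hh : h.IsHomogeneous δ) (hQ' : ∀ x, h * x ∈ Q ↔ x ∈ Q') :
    hilbertSeries Q = hilbertSeries (Q ⊔ Ideal.span {h}) +
      PowerSeries.X ^ δ * hilbertSeries Q' := by
  ext k
  rw [map_add, PowerSeries.coeff_X_pow_mul', coeff_hilbertSeries, coeff_hilbertSeries]
  have h1 := hilbertFunction_add_finrank Q k
  have h2 := hilbertFunction_add_finrank (Q ⊔ Ideal.span {h}) k
  rcases lt_or_ge k δ with hk | hk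
  · rw [if_neg (by omega), add_zero]
    have : (homogeneousSubmodule (Fin (n + 1)) K k ⊓ Q.restrictScalars K : Submodule K _) =
        homogeneousSubmodule (Fin (n + 1)) K k ⊓ (Q ⊔ Ideal.span {h}).restrictScalars K := by
      ext x
      simp only [Submodule.mem_inf, mem_homogeneousSubmodule, Submodule.restrictScalars_mem]
      refine and_congr_right fun hx => ⟨fun hxQ => Ideal.mem_sup_left hxQ, fun hxQ => ?_⟩
      rcases exists_isHomogeneous_of_mem_sup_span hQ hh hx hxQ with h | ⟨h, _⟩
      · exact h
      · omega
    rw [this] at h1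
    norm_cast
    omega
  · rw [if_pos hk, coeff_hilbertSeries]
    let f : MvPolynomial (Fin (n + 1)) K →ₗ[K] MvPolynomial (Fin (n + 1)) K ⧸ Q :=
      (Ideal.Quotient.mkₐ K Q).toLinearMap ∘ₗ LinearMap.mulLeft K h
    have hker : LinearMap.ker f = Q'.restrictScalars K := by
      ext x
      simp only [f, LinearMap.mem_ker, LinearMap.comp_apply, LinearMap.mulLeft_apply,
        Submodule.restrictScalars_mem, ← hQ']
      exact Ideal.Quotient.eq_zero_iff_mem
    have h3 := hilbertFunction_add_finrank Q' (k - δ)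
    have h4 := finrank_map_add_finrank_inf_ker f (homogeneousSubmodule (Fin (n + 1)) K (k - δ))
    rw [hker] at h4
    -- The degree `k` part of `(Q, h)`. Its image in `S/Q` is that of multiplication by `h` from
    -- degree `k - δ`, whose kernel is given by `Q'`.
    let A : Submodule K (MvPolynomial (Fin (n + 1)) K) :=
      homogeneousSubmodule (Fin (n + 1)) K k ⊓ (Q ⊔ Ideal.span {h}).restrictScalars K
    have : FiniteDimensional K A := Submodule.finiteDimensional_of_le inf_le_left
    have h5 := finrank_map_add_finrank_inf_ker (Ideal.Quotient.mkₐ K Q).toLinearMap A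
    have hA1 : A ⊓ LinearMap.ker (Ideal.Quotient.mkₐ K Q).toLinearMap =
        homogeneousSubmodule (Fin (n + 1)) K k ⊓ Q.restrictScalars K := by
      rw [ker_mkₐ_toLinearMap]
      apply le_antisymm
      · exact inf_le_inf_right _ inf_le_left
      · refine le_inf (inf_le_inf_left _ ?_) inf_le_right
        exact fun x hx => Ideal.mem_sup_left hx
    have hA2 : A.map (Ideal.Quotient.mkₐ K Q).toLinearMap =
        (homogeneousSubmodule (Fin (n + 1)) K (k - δ)).map f := by
      apply le_antisymm
      · rintro _ ⟨x, ⟨hx, hxQ⟩, rfl⟩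
        rcases exists_isHomogeneous_of_mem_sup_span hQ hh hx hxQ with h | ⟨_, u, hu, hxu⟩
        · refine ⟨0, Submodule.zero_mem _, ?_⟩
          rw [map_zero]
          exact (Ideal.Quotient.eq_zero_iff_mem.2 h).symm
        · exact ⟨u, hu, (Ideal.Quotient.eq.2 hxu).symm⟩
      · rintro _ ⟨u, hu, rfl⟩
        refine ⟨h * u, ⟨?_, ?_⟩, rfl⟩
        · have : (h * u).IsHomogeneous (δ + (k - δ)) := hh.mul hu
          rwa [Nat.add_sub_cancel' hk] at this
        · exact Ideal.mem_sup_right (Ideal.mul_mem_right _ _ (Ideal.mem_span_singleton_self h))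
    rw [hA1, hA2] at h5
    change _ + Module.finrank K A = _ at h2
    norm_cast
    omega

lemma IsPermRegular.hilbertSeries_span_image {ι : Type*}
    {y : ι → MvPolynomial (Fin (n + 1)) K} {a : ι → ℕ} (hy : IsPermRegular y)
    (ha : ∀ i, (y i).IsHomogeneous (a i)) (s : Finset ι) :
    hilbertSeries (Ideal.span (y '' s)) =
      (∏ i ∈ s, (1 - PowerSeries.X ^ a i)) * hilbertSeries (K := K) (n := n) ⊥ := by
  classical
  induction s using Finset.induction_on with
  | empty => simp
  | insert i s hi ih =>
    have hi' : i ∉ (s : Set ι) := by simpa using hi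
    have := hilbertSeries_eq_add (isHomogeneousIdeal_span_image ha s) (ha i)
      (Q' := Ideal.span (y '' s)) fun x => ⟨hy s i hi' x, fun hx => Ideal.mul_mem_left _ _ hx⟩
    rw [Finset.prod_insert hi, mul_assoc, ← ih, Finset.coe_insert, span_image_insert]
    linear_combination -this

/-- The irrelevant ideal `(x_0, …, x_n)`. -/
abbrev irrelevantIdeal (K : Type*) [Field K] (n : ℕ) : Ideal (MvPolynomial (Fin (n + 1)) K) :=
  Ideal.span (Set.range X)

lemma mem_irrelevantIdeal_of_isHomogeneous {x : MvPolynomial (Fin (n + 1)) K} {k : ℕ}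
    (hx : x.IsHomogeneous k) (hk : 0 < k) : x ∈ irrelevantIdeal K n := by
  rw [irrelevantIdeal, ← Set.image_univ, mem_ideal_span_X_image]
  intro m hm
  by_contra! h
  have : m = 0 := Finsupp.ext fun i => h i trivial
  have h1 := hx (mem_support_iff.1 hm)
  rw [this, map_zero] at h1
  omega

lemma one_notMem_irrelevantIdeal : (1 : MvPolynomial (Fin (n + 1)) K) ∉ irrelevantIdeal K n := by
  rw [irrelevantIdeal, ← Set.image_univ, mem_ideal_span_X_image]
  intro h
  obtain ⟨i, _, hi⟩ := h 0 (by simp)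
  simp at hi

/-- Combined with regularity of the variables this gives `H_S (1 - t)^(n + 1) = 1` without counting
monomials. -/
lemma hilbertSeries_irrelevantIdeal : hilbertSeries (irrelevantIdeal K n) = 1 := by
  ext k
  rw [coeff_hilbertSeries, PowerSeries.coeff_one]
  have h := hilbertFunction_add_finrank (irrelevantIdeal K n) k
  split_ifs with hk
  · subst hk
    have h0 : Module.finrank K (homogeneousSubmodule (Fin (n + 1)) K 0) = 1 := by
      rw [homogeneousSubmodule_zero, Submodule.one_eq_span]
      exact finrank_span_singleton one_ne_zero
    have h1 : (homogeneousSubmodule (Fin (n + 1)) K 0 ⊓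
        (irrelevantIdeal K n).restrictScalars K : Submodule K _) = ⊥ := by
      rw [eq_bot_iff]
      rintro x ⟨hx, hxm⟩
      rw [SetLike.mem_coe, homogeneousSubmodule_zero, Submodule.mem_one] at hx
      obtain ⟨c, rfl⟩ := hx
      rw [Submodule.mem_bot]
      by_contra hc
      refine one_notMem_irrelevantIdeal (K := K) (n := n) ?_
      have hc0 : c ≠ 0 := by rintro rfl; simp at hc
      have := Ideal.mul_mem_left (irrelevantIdeal K n) (algebraMap K _ c⁻¹) hxm
      rwa [← map_mul, inv_mul_cancel₀ hc0, map_one] at this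
    rw [h0, h1, finrank_bot] at h
    simpa using h
  · have : (homogeneousSubmodule (Fin (n + 1)) K k ⊓
        (irrelevantIdeal K n).restrictScalars K : Submodule K _) =
        homogeneousSubmodule (Fin (n + 1)) K k :=
      inf_eq_left.2 fun x hx => mem_irrelevantIdeal_of_isHomogeneous hx (by omega)
    rw [this] at h
    simpa using h

/-- The Hilbert series of a complete intersection. -/
lemma IsPermRegular.hilbertSeries_mul {ι : Type*} [Fintype ι]
    {y : ι → MvPolynomial (Fin (n + 1)) K} {a : ι → ℕ} (hy : IsPermRegular y)
    (ha : ∀ i, (y i).IsHomogeneous (a i)) :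
    hilbertSeries (Ideal.span (Set.range y)) * (1 - PowerSeries.X) ^ (n + 1) =
      ∏ i, (1 - PowerSeries.X ^ a i) := by
  have h1 := isPermRegular_X.hilbertSeries_span_image
    (fun i => isHomogeneous_X K i) (Finset.univ : Finset (Fin (n + 1)))
  have h2 := hy.hilbertSeries_span_image ha Finset.univ
  rw [Finset.coe_univ, Set.image_univ] at h1 h2
  rw [hilbertSeries_irrelevantIdeal] at h1
  simp only [pow_one, Finset.prod_const, Finset.card_univ, Fintype.card_fin] at h1
  rw [h2, mul_assoc, mul_comm (hilbertSeries ⊥), ← h1, mul_one]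

end Hilbert

/-! ### Exchange by general forms, and the resulting Hilbert series -/

section Exchange

variable {K : Type*} [Field K] {n : ℕ}

lemma span_range_eq_sup {ι : Type*} (y : ι → MvPolynomial (Fin (n + 1)) K) (i : ι) :
    Ideal.span (Set.range y) = Ideal.span (y '' {i}ᶜ) ⊔ Ideal.span {y i} := by
  rw [← span_image_insert, ← Set.image_univ]
  congr 2
  ext j
  simp [em]

lemma one_notMem_span_range {ι : Type*} {y : ι → MvPolynomial (Fin (n + 1)) K} {a : ι → ℕ}
    (ha : ∀ i, (y i).IsHomogeneous (a i)) (ha0 : ∀ i, 0 < a i) :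
    (1 : MvPolynomial (Fin (n + 1)) K) ∉ Ideal.span (Set.range y) := fun h =>
  one_notMem_irrelevantIdeal (Ideal.span_le.2 (by
    rintro _ ⟨i, rfl⟩
    exact mem_irrelevantIdeal_of_isHomogeneous (ha i) (ha0 i)) h)

/-- If `(V)` and `(y)` agree up to `𝔪`-torsion, then the members of a permutable regular sequence
`y` can be replaced one after the other by general elements of the space `V` of forms. -/
theorem exists_exchange [Infinite K] {ι : Type*} [Finite ι]
    {y : ι → MvPolynomial (Fin (n + 1)) K} {a : ι → ℕ} (hy : IsPermRegular y)
    (ha : ∀ i, (y i).IsHomogeneous (a i)) (ha0 : ∀ i, 0 < a i)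
    (V : Submodule K (MvPolynomial (Fin (n + 1)) K)) {e : ℕ}
    (hVe : ∀ v ∈ V, v.IsHomogeneous e) (hVy : ∀ v ∈ V, v ∈ Ideal.span (Set.range y)) {N : ℕ}
    (hN : ∀ z ∈ irrelevantIdeal K n ^ N, ∀ i, z * y i ∈ Ideal.span (V : Set _)) (s : Finset ι) :
    ∃ c : ι → MvPolynomial (Fin (n + 1)) K, (∀ i ∈ s, c i ∈ V) ∧ (∀ i ∉ s, c i = y i) ∧
      IsPermRegular c ∧
      (∃ D M, M.IsHomogeneous D ∧ D + ∑ i ∈ s, a i = s.card * e ∧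
        IsLink (Ideal.span (Set.range c)) (Ideal.span (Set.range y)) M) ∧
      (IsSaturatedBy (irrelevantIdeal K n) (Ideal.span (Set.range y)) →
        IsSaturatedBy (irrelevantIdeal K n) (Ideal.span (Set.range c))) := by
  classical
  induction s using Finset.induction_on with
  | empty =>
    exact ⟨y, by simp, by simp, hy, ⟨0, 1, isHomogeneous_one _ _, by simp, .refl _⟩, id⟩
  | insert i s hi ih =>
    obtain ⟨c, hcV, hcy, hc, ⟨D, M, hM, hD, hlink⟩, hsat⟩ := ih
    have hci : c i = y i := hcy i hi
    obtain ⟨v, hvV, hv⟩ := exists_isRegularMod (α := {T : Set ι // i ∉ T})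
        (fun T => Ideal.span (c '' T)) V (by
      -- If an associated prime `P` of `(c_T)` contained `V`, then `𝔪 ^ N * y i ⊆ P`. As `y i` is
      -- regular modulo `(c_T)`, it is not in `P`; hence `𝔪 ⊆ P`, which does contain `y i` because
      -- its degree is positive.
      rintro ⟨T, hT⟩ P hP x hx hPx hVP
      have hyP : y i ∉ P := fun h => hx (hc T i hT x (by
        rw [mul_comm, hci]
        exact (hPx _).1 h))
      have hle : irrelevantIdeal K n ^ N ≤ P := fun z hz =>
        (hP.mem_or_mem (Ideal.span_le.2 hVP (hN z hz i))).resolve_right hyP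
      exact hyP (hP.le_of_pow_le hle (mem_irrelevantIdeal_of_isHomogeneous (ha i) (ha0 i))))
    have hvQ : IsRegularMod (Ideal.span (c '' {i}ᶜ)) v := hv ⟨{i}ᶜ, by simp⟩
    have hgQ : IsRegularMod (Ideal.span (c '' {i}ᶜ)) (y i) := hci ▸ hc {i}ᶜ i (by simp)
    have hQhom : IsHomogeneousIdeal (Ideal.span (c '' {i}ᶜ)) :=
      isHomogeneousIdeal_span (by
        rintro _ ⟨j, _, rfl⟩
        by_cases hj : j ∈ s
        · exact ⟨e, hVe _ (hcV j hj)⟩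
        · exact ⟨a j, hcy j hj ▸ ha j⟩)
    have hspan : Ideal.span (Set.range (Function.update c i v)) =
        Ideal.span (c '' {i}ᶜ) ⊔ Ideal.span {v} := by
      rw [span_range_eq_sup _ i, Function.update_self]
      congr 2
      exact Set.image_congr fun j hj => Function.update_of_ne hj _ _
    rw [span_range_eq_sup c i, hci] at hlink hsat
    have hyi : y i ∈ Ideal.span (Set.range y) := Ideal.subset_span ⟨i, rfl⟩
    have hMv : M * v ∈ Ideal.span (c '' {i}ᶜ) ⊔ Ideal.span {y i} :=
      (hlink.mul_mem_iff v).2 (hVy v hvV)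
    refine ⟨Function.update c i v, ?_, ?_, ?_, ?_, ?_⟩
    · intro j hj
      rcases eq_or_ne j i with rfl | hji
      · simpa using hvV
      · rw [Function.update_of_ne hji]
        exact hcV j (Finset.mem_of_mem_insert_of_ne hj hji)
    · intro j hj
      rw [Finset.mem_insert, not_or] at hj
      rw [Function.update_of_ne hj.1]
      exact hcy j hj.2
    · exact hc.update fun T hT => hv ⟨T, hT⟩
    -- Dividing `M v` by `y i` modulo the other generators gives the next link form `u`, of degree
    -- `D + e - a i`. If instead `M v` lay in the ideal of the others, so would `M`, and then `1 ∈
    -- (y)`.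
    · rcases exists_isHomogeneous_of_mem_sup_span hQhom (ha i) (hM.mul (hVe v hvV)) hMv with
        h | ⟨hle, u, hu, hMu⟩
      · exfalso
        refine one_notMem_span_range ha ha0 ((hlink.mul_mem_iff 1).1 ?_)
        rw [mul_one]
        exact Ideal.mem_sup_left (hvQ M (by rwa [mul_comm]))
      · refine ⟨_, u, hu, ?_, ?_⟩
        · rw [Finset.sum_insert hi, Finset.card_insert_of_notMem hi, add_mul, ← hD]
          omega
        · rw [hspan]
          exact hlink.exchange hgQ hvQ hyi (by rwa [mul_comm u])
    · intro h
      rw [hspan]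
      exact (hsat h).exchange hgQ hvQ (mem_irrelevantIdeal_of_isHomogeneous (ha i) (ha0 i))

/-- If `c i` lay in the span of the others, regularity modulo their ideal would put `1` into it.
Hence the exchanged forms fill all but at most one dimension of `V`. -/
lemma IsPermRegular.linearIndependent {ι : Type*} {c : ι → MvPolynomial (Fin (n + 1)) K}
    (hc : IsPermRegular c) (h1 : (1 : MvPolynomial (Fin (n + 1)) K) ∉ Ideal.span (Set.range c)) :
    LinearIndependent K c := by
  rw [linearIndependent_iff_notMem_span]
  intro i hi
  refine h1 (Ideal.span_mono (Set.image_subset_range c {i}ᶜ) (hc {i}ᶜ i (by simp) 1 ?_))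
  rw [mul_one, Set.compl_eq_univ_sdiff]
  exact Submodule.span_le_restrictScalars K _ _ hi

lemma exists_sup_span_singleton_eq {W : Type*} [AddCommGroup W] [Module K W] {V U : Submodule K W}
    [FiniteDimensional K V] (hU : U ≤ V) (h : Module.finrank K V ≤ Module.finrank K U + 1) :
    ∃ w ∈ V, U ⊔ Submodule.span K {w} = V := by
  by_cases hVU : V ≤ U
  · exact ⟨0, V.zero_mem, by simp [le_antisymm hU hVU]⟩
  · obtain ⟨w, hw, hwU⟩ := SetLike.not_le_iff_exists.1 hVU
    have hle : U ⊔ Submodule.span K {w} ≤ V :=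
      sup_le hU ((Submodule.span_singleton_le_iff_mem _ _).2 hw)
    refine ⟨w, hw, Submodule.eq_of_le_of_finrank_le hle (h.trans ?_)⟩
    have : FiniteDimensional K (U ⊔ Submodule.span K {w} : Submodule K W) :=
      Submodule.finiteDimensional_of_le hle
    refine Submodule.finrank_lt_finrank_of_lt (lt_of_le_of_ne le_sup_left fun h => hwU ?_)
    rw [h]
    exact Submodule.mem_sup_right (Submodule.mem_span_singleton_self w)

lemma ideal_span_sup (U₁ U₂ : Submodule K (MvPolynomial (Fin (n + 1)) K)) :
    Ideal.span ((U₁ ⊔ U₂ : Submodule K _) : Set (MvPolynomial (Fin (n + 1)) K)) =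
      Ideal.span (U₁ : Set _) ⊔ Ideal.span (U₂ : Set _) := by
  apply le_antisymm
  · rw [Ideal.span_le]
    intro x hx
    obtain ⟨y, hy, z, hz, rfl⟩ := Submodule.mem_sup.1 hx
    exact Submodule.add_mem_sup (Ideal.subset_span hy) (Ideal.subset_span hz)
  · exact sup_le (Ideal.span_mono fun x hx => Submodule.mem_sup_left hx)
      (Ideal.span_mono fun x hx => Submodule.mem_sup_right hx)

lemma ideal_span_span (s : Set (MvPolynomial (Fin (n + 1)) K)) :
    Ideal.span (Submodule.span K s : Set (MvPolynomial (Fin (n + 1)) K)) = Ideal.span s :=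
  Submodule.span_span_of_tower K _ s

/-- The Hilbert series of an almost complete intersection `(V)` whose saturation is a complete
intersection `(y)`. -/
theorem hilbertSeries_mul_of_saturation [Infinite K] {ι : Type*} [Fintype ι]
    {y : ι → MvPolynomial (Fin (n + 1)) K} {a : ι → ℕ} (hy : IsPermRegular y)
    (ha : ∀ i, (y i).IsHomogeneous (a i)) (ha0 : ∀ i, 0 < a i)
    (hsat : IsSaturatedBy (irrelevantIdeal K n) (Ideal.span (Set.range y)))
    (V : Submodule K (MvPolynomial (Fin (n + 1)) K)) [FiniteDimensional K V]
    (hV : Module.finrank K V ≤ Fintype.card ι + 1) {e : ℕ} (he : 0 < e)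
    (hVe : ∀ v ∈ V, v.IsHomogeneous e) (hVy : ∀ v ∈ V, v ∈ Ideal.span (Set.range y)) {N : ℕ}
    (hN : ∀ z ∈ irrelevantIdeal K n ^ N, ∀ i, z * y i ∈ Ideal.span (V : Set _)) :
    ∃ D, D + ∑ i, a i = Fintype.card ι * e ∧
      hilbertSeries (Ideal.span (V : Set (MvPolynomial (Fin (n + 1)) K))) *
        (1 - PowerSeries.X) ^ (n + 1) = (1 - PowerSeries.X ^ e) ^ (Fintype.card ι + 1) +
          PowerSeries.X ^ (e + D) * ∏ i, (1 - PowerSeries.X ^ a i) := by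
  obtain ⟨c, hcV, -, hc, ⟨D, M, hM, hD, hlink⟩, hcsat⟩ :=
    exists_exchange hy ha ha0 V hVe hVy hN Finset.univ
  replace hcV := fun i => hcV i (Finset.mem_univ i)
  have hce := fun i => hVe _ (hcV i)
  specialize hcsat hsat
  have hli := hc.linearIndependent (one_notMem_span_range hce fun _ => he)
  obtain ⟨w, hwV, hw⟩ := exists_sup_span_singleton_eq (U := Submodule.span K (Set.range c))
    (V := V) (Submodule.span_le.2 (by rintro _ ⟨i, rfl⟩; exact hcV i))
    (by rwa [finrank_span_eq_card hli])
  have hJ : Ideal.span (V : Set _) = Ideal.span (Set.range c) ⊔ Ideal.span {w} := by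
    rw [← hw, ideal_span_sup, ideal_span_span, ideal_span_span]
  have hcolon : ∀ x, w * x ∈ Ideal.span (Set.range c) ↔
      x ∈ Ideal.span (Set.range c) ⊔ Ideal.span {M} := by
    intro x
    constructor
    · intro hx
      -- From `x w ∈ (c)` follows `x J ⊆ (c)`, so `x 𝔪 ^ N I ⊆ (c)`; saturatedness of `(c)` removes
      -- `𝔪 ^ N`, and the link gives `x ∈ (c, M)`.
      have hxJ : ∀ j ∈ Ideal.span (V : Set _), x * j ∈ Ideal.span (Set.range c) := by
        intro j hj
        rw [hJ] at hj
        obtain ⟨p, hp, q, hq, rfl⟩ := Submodule.mem_sup.1 hj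
        obtain ⟨u, rfl⟩ := Ideal.mem_span_singleton.1 hq
        rw [mul_add]
        refine Ideal.add_mem _ (Ideal.mul_mem_left _ _ hp) ?_
        rw [← mul_assoc, mul_comm x]
        exact Ideal.mul_mem_right _ _ hx
      refine hlink.mem_of_colon x fun j hj => hcsat.pow N _ fun z hz => ?_
      rw [mul_assoc]
      apply hxJ
      rw [mul_comm]
      refine Submodule.span_induction (p := fun j _ => z * j ∈ Ideal.span (V : Set _))
        ?_ ?_ ?_ ?_ hj
      · rintro _ ⟨i, rfl⟩
        exact hN z hz i
      · simp
      · intro p q _ _ hp hq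
        rw [mul_add]
        exact Ideal.add_mem _ hp hq
      · intro r p _ hp
        rw [smul_eq_mul, mul_left_comm]
        exact Ideal.mul_mem_left _ _ hp
    · intro hx
      obtain ⟨p, hp, q, hq, rfl⟩ := Submodule.mem_sup.1 hx
      obtain ⟨u, rfl⟩ := Ideal.mem_span_singleton.1 hq
      rw [mul_add]
      refine Ideal.add_mem _ (Ideal.mul_mem_left _ _ hp) ?_
      rw [← mul_assoc, mul_comm w]
      exact Ideal.mul_mem_right _ _ ((hlink.mul_mem_iff w).2 (hVy w hwV))
  have hhom : IsHomogeneousIdeal (Ideal.span (Set.range c)) := by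
    rw [← Set.image_univ]
    exact isHomogeneousIdeal_span_image hce _
  refine ⟨D, hD, ?_⟩
  have h1 := hilbertSeries_eq_add hhom (hVe w hwV) hcolon
  have h2 := hilbertSeries_eq_add hhom hM hlink.mul_mem_iff
  have h3 := hc.hilbertSeries_mul hce
  have h4 := hy.hilbertSeries_mul ha
  rw [Finset.prod_const, Finset.card_univ] at h3
  rw [← hJ] at h1
  rw [pow_succ, pow_add, ← h3, ← h4]
  linear_combination (-(1 - PowerSeries.X) ^ (n + 1)) * h1 +
    (PowerSeries.X ^ e * (1 - PowerSeries.X) ^ (n + 1)) * h2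

/-- The Hilbert series of the ideal of a space `V` of forms with empty zero locus. -/
theorem hilbertSeries_mul_of_irrelevant [Infinite K]
    (V : Submodule K (MvPolynomial (Fin (n + 1)) K)) [FiniteDimensional K V]
    (hV : Module.finrank K V ≤ n + 1) {e : ℕ} (he : 0 < e)
    (hVe : ∀ v ∈ V, v.IsHomogeneous e) {N : ℕ}
    (hN : irrelevantIdeal K n ^ N ≤ Ideal.span (V : Set _)) :
    hilbertSeries (Ideal.span (V : Set (MvPolynomial (Fin (n + 1)) K))) *
      (1 - PowerSeries.X) ^ (n + 1) = (1 - PowerSeries.X ^ e) ^ (n + 1) := by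
  obtain ⟨c, hcV, -, hc, -, -⟩ :=
    exists_exchange isPermRegular_X (fun i => isHomogeneous_X K i) (fun _ => one_pos) V hVe
      (fun v hv => mem_irrelevantIdeal_of_isHomogeneous (hVe v hv) he)
      (fun z hz i => Ideal.mul_mem_right _ _ (hN hz)) Finset.univ
  replace hcV := fun i => hcV i (Finset.mem_univ i)
  have hce := fun i => hVe _ (hcV i)
  have hli := hc.linearIndependent (one_notMem_span_range hce fun _ => he)
  have hspan : Submodule.span K (Set.range c) = V :=
    Submodule.eq_of_le_of_finrank_le (Submodule.span_le.2 (by rintro _ ⟨i, rfl⟩; exact hcV i))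
      (by rwa [finrank_span_eq_card hli, Fintype.card_fin])
  rw [← hspan, ideal_span_span, hc.hilbertSeries_mul hce, Finset.prod_const, Finset.card_univ,
    Fintype.card_fin]

end Exchange

/-! ### Jacobian ideals and smooth hypersurfaces -/

section Jacobian

variable {K : Type*} [Field K] {n : ℕ}

/-- The space spanned by the partial derivatives. -/
def partialsSpan (f : MvPolynomial (Fin (n + 1)) K) : Submodule K (MvPolynomial (Fin (n + 1)) K) :=
  Submodule.span K (Set.range fun j => pderiv j f)

instance (f : MvPolynomial (Fin (n + 1)) K) : FiniteDimensional K (partialsSpan f) :=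
  FiniteDimensional.span_of_finite K (Set.finite_range _)

lemma finrank_partialsSpan_le (f : MvPolynomial (Fin (n + 1)) K) :
    Module.finrank K (partialsSpan f) ≤ n + 1 := by
  have h := finrank_range_le_card (R := K) fun j => pderiv j f
  rwa [Fintype.card_fin] at h

lemma ideal_span_partialsSpan (f : MvPolynomial (Fin (n + 1)) K) :
    Ideal.span (partialsSpan f : Set _) = jacobianIdeal f := ideal_span_span _

lemma isHomogeneous_of_mem_partialsSpan {f : MvPolynomial (Fin (n + 1)) K} {d : ℕ}
    (hf : f.IsHomogeneous d) {v : MvPolynomial (Fin (n + 1)) K} (hv : v ∈ partialsSpan f) :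
    v.IsHomogeneous (d - 1) := by
  have : partialsSpan f ≤ homogeneousSubmodule (Fin (n + 1)) K (d - 1) :=
    Submodule.span_le.2 (by rintro _ ⟨j, rfl⟩; exact hf.pderiv)
  exact this hv

/-- Euler's relation, with `d` invertible in characteristic zero. -/
lemma mem_jacobianIdeal [CharZero K] {f : MvPolynomial (Fin (n + 1)) K} {d : ℕ}
    (hf : f.IsHomogeneous d) (hd : 0 < d) : f ∈ jacobianIdeal f := by
  have h : (d : K) • f ∈ jacobianIdeal f := by
    rw [Nat.cast_smul_eq_nsmul, ← hf.sum_X_mul_pderiv]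
    exact Ideal.sum_mem _ fun j _ => Ideal.mul_mem_left _ _ (Ideal.subset_span ⟨j, rfl⟩)
  have h2 := Submodule.smul_of_tower_mem (jacobianIdeal f) (d : K)⁻¹ h
  rwa [smul_smul, inv_mul_cancel₀ (Nat.cast_ne_zero.2 hd.ne'), one_smul] at h2

lemma not_irrelevantIdeal_le (p : Point K n) : ∃ i, X i ∉ p.asHomogeneousIdeal := by
  by_contra! h
  refine p.not_irrelevant_le fun x hx => ?_
  rw [HomogeneousIdeal.mem_irrelevant_iff] at hx
  have hle : irrelevantIdeal K n ≤ p.asHomogeneousIdeal.toIdeal :=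
    Ideal.span_le.2 (by rintro _ ⟨i, rfl⟩; exact h i)
  change x ∈ p.asHomogeneousIdeal.toIdeal
  rw [mem_iff_homogeneousComponent_mem p.asHomogeneousIdeal.isHomogeneous]
  intro k
  rcases Nat.eq_zero_or_pos k with rfl | hk
  · rw [GradedRing.proj_apply, coe_decompose_eq_homogeneousComponent] at hx
    rw [hx]
    exact Ideal.zero_mem _
  · exact hle (mem_irrelevantIdeal_of_isHomogeneous (homogeneousComponent_isHomogeneous k x) hk)

lemma mem_singularLocus_iff [CharZero K] {f : MvPolynomial (Fin (n + 1)) K} {d : ℕ}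
    (hf : f.IsHomogeneous d) (hd : 0 < d) (p : Point K n) :
    p ∈ singularLocus f ↔ jacobianIdeal f ≤ p.asHomogeneousIdeal.toIdeal := by
  constructor
  · intro h
    refine Ideal.span_le.2 ?_
    rintro _ ⟨j, rfl⟩
    exact h.2 j
  · intro h
    exact ⟨h (mem_jacobianIdeal hf hd), fun j => h (Ideal.subset_span ⟨j, rfl⟩)⟩

/-- If a prime contains `J_f` but not `𝔪`, its homogeneous core is a point of `ℙⁿ` in the singular
locus. So every prime over `J_f` contains `𝔪`, that is, `𝔪` lies in the radical. -/
lemma exists_pow_irrelevantIdeal_le [CharZero K] {f : MvPolynomial (Fin (n + 1)) K} {d : ℕ}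
    (hf : f.IsHomogeneous d) (hd : 0 < d) (h : singularLocus f = ∅) :
    ∃ N, irrelevantIdeal K n ^ N ≤ jacobianIdeal f := by
  refine Ideal.exists_pow_le_of_le_radical_of_fg ?_ (IsNoetherian.noetherian _)
  rw [Ideal.radical_eq_sInf]
  refine le_sInf ?_
  rintro P ⟨hJP, hP⟩
  have hle : jacobianIdeal f ≤
      (P.homogeneousCore (homogeneousSubmodule (Fin (n + 1)) K)).toIdeal := by
    refine Ideal.span_le.2 ?_
    rintro _ ⟨j, rfl⟩
    exact Ideal.mem_homogeneousCore_of_homogeneous_of_mem ⟨_, hf.pderiv⟩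
      (hJP (Ideal.subset_span ⟨j, rfl⟩))
  by_contra hmP
  have hcore := Ideal.toIdeal_homogeneousCore_le (homogeneousSubmodule (Fin (n + 1)) K) P
  let p : Point K n := ⟨P.homogeneousCore _, hP.homogeneousCore, fun hirr => hmP (Ideal.span_le.2 (by
    rintro _ ⟨i, rfl⟩
    refine hcore (hirr ?_)
    change (X i : MvPolynomial (Fin (n + 1)) K) ∈ HomogeneousIdeal.irrelevant _
    rw [HomogeneousIdeal.mem_irrelevant_iff, GradedRing.proj_apply,
      coe_decompose_eq_homogeneousComponent,
      homogeneousComponent_of_mem ((mem_homogeneousSubmodule 1 _).2 (isHomogeneous_X K i))]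
    simp))⟩
  have : p ∈ singularLocus f := (mem_singularLocus_iff hf hd p).2 hle
  rw [h] at this
  exact this

/-- The Hilbert series of the Milnor algebra of a smooth hypersurface. -/
theorem hilbertSeries_jacobianIdeal_of_smooth [CharZero K] {f : MvPolynomial (Fin (n + 1)) K}
    {d : ℕ} (hf : f.IsHomogeneous d) (hd : 2 ≤ d) (h : singularLocus f = ∅) :
    hilbertSeries (jacobianIdeal f) * (1 - PowerSeries.X) ^ (n + 1) =
      (1 - PowerSeries.X ^ (d - 1)) ^ (n + 1) := by
  obtain ⟨N, hN⟩ := exists_pow_irrelevantIdeal_le hf (by omega) h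
  have : Infinite K := Infinite.of_injective (Nat.cast : ℕ → K) Nat.cast_injective
  rw [← ideal_span_partialsSpan] at hN ⊢
  exact hilbertSeries_mul_of_irrelevant (partialsSpan f) (finrank_partialsSpan_le f) (by omega)
    (fun v hv => isHomogeneous_of_mem_partialsSpan hf hv) hN

/-- The Fermat hypersurface. -/
lemma exists_smooth [CharZero K] {d : ℕ} (hd : 2 ≤ d) :
    ∃ f : MvPolynomial (Fin (n + 1)) K, f.IsHomogeneous d ∧ singularLocus f = ∅ := by
  refine ⟨∑ i, X i ^ d, IsHomogeneous.sum _ _ _ fun i _ => isHomogeneous_X_pow i d, ?_⟩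
  rw [Set.eq_empty_iff_forall_notMem]
  rintro p ⟨-, hp⟩
  obtain ⟨i, hi⟩ := not_irrelevantIdeal_le p
  have h := hp i
  have hprime := p.isPrime
  have hderiv : pderiv i (∑ j, X j ^ d : MvPolynomial (Fin (n + 1)) K) =
      C (d : K) * X i ^ (d - 1) := by
    rw [map_sum, Finset.sum_eq_single i]
    · rw [Derivation.leibniz_pow, pderiv_X_self]
      simp
    · intro j _ hj
      rw [Derivation.leibniz_pow, pderiv_X_of_ne hj]
      simp
    · simp
  rw [hderiv] at h
  have h2 : (X i : MvPolynomial (Fin (n + 1)) K) ^ (d - 1) ∈ p.asHomogeneousIdeal.toIdeal := by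
    have := Ideal.mul_mem_left p.asHomogeneousIdeal.toIdeal (C (d : K)⁻¹) h
    rwa [← mul_assoc, ← C_mul, inv_mul_cancel₀ (Nat.cast_ne_zero.2 (by omega)), C_1, one_mul]
      at this
  exact hi (hprime.mem_of_pow_mem _ h2)

end Jacobian

/-! ### Saturation with respect to the irrelevant ideal -/

section Saturation

variable {K : Type*} [Field K] {n : ℕ}

lemma mem_saturation_iff (J : Ideal (MvPolynomial (Fin (n + 1)) K))
    (x : MvPolynomial (Fin (n + 1)) K) :
    x ∈ saturation J ↔ ∃ N, ∀ z ∈ irrelevantIdeal K n ^ N, x * z ∈ J := by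
  rw [saturation, Submodule.mem_iSup_of_directed]
  · refine exists_congr fun N => ?_
    rw [Submodule.mem_colon]
    rfl
  · refine Monotone.directed_le fun a b hab => ?_
    exact Submodule.colon_mono le_rfl (Ideal.pow_le_pow_right hab)

lemma le_saturation (J : Ideal (MvPolynomial (Fin (n + 1)) K)) : J ≤ saturation J := fun _ hx =>
  (mem_saturation_iff J _).2 ⟨0, fun _ _ => Ideal.mul_mem_right _ _ hx⟩

lemma isSaturatedBy_saturation (J : Ideal (MvPolynomial (Fin (n + 1)) K)) :
    IsSaturatedBy (irrelevantIdeal K n) (saturation J) := by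
  intro x hx
  have hfin : ∃ N, ∀ i, ∀ z ∈ irrelevantIdeal K n ^ N, x * X i * z ∈ J := by
    have := fun i => (mem_saturation_iff J _).1 (hx (X i) (Ideal.subset_span ⟨i, rfl⟩))
    choose N hN using this
    exact ⟨Finset.univ.sup N, fun i z hz => hN i z
      (Ideal.pow_le_pow_right (Finset.le_sup (Finset.mem_univ i)) hz)⟩
  obtain ⟨N, hN⟩ := hfin
  refine (mem_saturation_iff J x).2 ⟨N + 1, fun z hz => ?_⟩
  rw [pow_succ'] at hz
  refine Submodule.mul_induction_on hz (fun m hm w hw => ?_) fun p q hp hq => ?_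
  · refine Submodule.span_induction (p := fun m _ => x * (m * w) ∈ J) ?_ ?_ ?_ ?_ hm
    · rintro _ ⟨i, rfl⟩
      rw [← mul_assoc]
      exact hN i w hw
    · simp
    · intro p q _ _ hp hq
      rw [add_mul, mul_add]
      exact J.add_mem hp hq
    · intro r p _ hp
      rw [smul_eq_mul, mul_assoc, mul_left_comm]
      exact J.mul_mem_left _ hp
  · rw [mul_add]
    exact J.add_mem hp hq

/-- One exponent serves the whole saturation because it serves the finitely many generators. -/
lemma exists_pow_mul_mem_of_saturation_eq {ι : Type*} [Fintype ι]
    {J : Ideal (MvPolynomial (Fin (n + 1)) K)} {y : ι → MvPolynomial (Fin (n + 1)) K}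
    (h : saturation J = Ideal.span (Set.range y)) :
    ∃ N, ∀ z ∈ irrelevantIdeal K n ^ N, ∀ x ∈ saturation J, z * x ∈ J := by
  have := fun i => (mem_saturation_iff J (y i)).1 (h ▸ Ideal.subset_span ⟨i, rfl⟩)
  choose N hN using this
  refine ⟨Finset.univ.sup N, fun z hz x hx => ?_⟩
  rw [h] at hx
  refine Submodule.span_induction (p := fun x _ => z * x ∈ J) ?_ ?_ ?_ ?_ hx
  · rintro _ ⟨i, rfl⟩
    rw [mul_comm]
    exact hN i z (Ideal.pow_le_pow_right (Finset.le_sup (Finset.mem_univ i)) hz)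
  · simp
  · intro p q _ _ hp hq
    rw [mul_add]
    exact J.add_mem hp hq
  · intro r p _ hp
    rw [smul_eq_mul, mul_left_comm]
    exact J.mul_mem_left _ hp

end Saturation

open HomogeneousLocalization

/-! ### The affine chart where a linear form does not vanish -/

section AwayAlgebra

variable {K : Type*} [Field K] {n : ℕ}

/-- The coordinate ring of the standard affine open `ℓ ≠ 0` of `ℙⁿ`. -/
abbrev AffineChart (l : MvPolynomial (Fin (n + 1)) K) :=
  Away (homogeneousSubmodule (Fin (n + 1)) K) l

instance (l : MvPolynomial (Fin (n + 1)) K) : Algebra K (AffineChart l) where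
  algebraMap := (algebraMap (homogeneousSubmodule (Fin (n + 1)) K 0) (AffineChart l)).comp
    (algebraMap K (homogeneousSubmodule (Fin (n + 1)) K 0))
  commutes' _ _ := mul_comm _ _
  smul_def' c x := by
    apply val_injective
    rw [val_smul, val_mul]
    change _ = Localization.mk (MvPolynomial.C c) 1 * _
    rw [Localization.mk_one_eq_algebraMap, ← Algebra.smul_def, ← MvPolynomial.algebraMap_eq,
      algebraMap_smul]

/-- The ideal of the affine chart `ℓ ≠ 0` defined by an ideal of the polynomial ring. -/
def chartIdeal (I : Ideal (MvPolynomial (Fin (n + 1)) K)) (l : MvPolynomial (Fin (n + 1)) K) :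
    Ideal (AffineChart l) :=
  (I.map (algebraMap _ (Localization.Away l))).comap (algebraMap _ (Localization.Away l))

lemma isRegularMod_pow {R : Type*} [CommRing R] {Q : Ideal R} {c : R} (h : IsRegularMod Q c)
    (k : ℕ) : IsRegularMod Q (c ^ k) := by
  induction k with
  | zero => intro x hx; simpa using hx
  | succ k ih => intro x hx; exact h x (ih _ (by rwa [← mul_assoc, ← pow_succ]))

/-- Membership after inverting `l` means that some `l ^ k` multiplies the numerator into `I`, and
such powers cancel modulo `I`. -/
lemma mk_mem_chartIdeal {I : Ideal (MvPolynomial (Fin (n + 1)) K)}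
    {l : MvPolynomial (Fin (n + 1)) K} (hl : IsRegularMod I l)
    (z : NumDenSameDeg (homogeneousSubmodule (Fin (n + 1)) K) (.powers l)) :
    HomogeneousLocalization.mk z ∈ chartIdeal I l ↔ (z.num : MvPolynomial (Fin (n + 1)) K) ∈ I := by
  rw [chartIdeal, Ideal.mem_comap, HomogeneousLocalization.algebraMap_apply, val_mk,
    Localization.mk_eq_mk', IsLocalization.mk'_mem_map_algebraMap_iff (.powers l)]
  constructor
  · rintro ⟨_, ⟨k, rfl⟩, h⟩
    exact isRegularMod_pow hl k _ h
  · intro h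
    exact ⟨1, one_mem _, by rwa [one_mul]⟩

variable {l : MvPolynomial (Fin (n + 1)) K} (hl1 : l.IsHomogeneous 1)

lemma isHomogeneous_pow_of_one (hl1 : l.IsHomogeneous 1) (k : ℕ) : (l ^ k).IsHomogeneous k := by
  simpa using hl1.pow k

/-- The linear map `a ↦ a / ℓ ^ k` on forms of degree `k`. -/
def divPow (k : ℕ) : homogeneousSubmodule (Fin (n + 1)) K k →ₗ[K] AffineChart l where
  toFun a := HomogeneousLocalization.mk ⟨k, a, ⟨l ^ k, isHomogeneous_pow_of_one hl1 k⟩, k, rfl⟩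
  map_add' a b := by
    apply val_injective
    simp only [val_add, val_mk, Submodule.coe_add]
    exact (Localization.add_mk_self _ _ _).symm
  map_smul' c a := by
    rw [RingHom.id_apply]
    apply val_injective
    rw [val_smul, val_mk, val_mk, Localization.smul_mk]
    rfl

lemma divPow_succ (k : ℕ) (a : homogeneousSubmodule (Fin (n + 1)) K k) :
    divPow hl1 k a = divPow hl1 (k + 1) ⟨a * l, IsHomogeneous.mul a.2 hl1⟩ := by
  apply val_injective
  simp only [divPow, LinearMap.coe_mk, AddHom.coe_mk, val_mk]
  rw [Localization.mk_eq_mk_iff, Localization.r_iff_exists]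
  refine ⟨1, ?_⟩
  simp only [OneMemClass.coe_one, one_mul]
  ring

lemma exists_divPow_eq (x : AffineChart l) : ∃ k a, divPow hl1 k a = x := by
  obtain ⟨k, a, ha, rfl⟩ := Away.mk_surjective (homogeneousSubmodule (Fin (n + 1)) K) hl1 x
  rw [nsmul_one, Nat.cast_id] at ha
  refine ⟨k, ⟨a, ha⟩, ?_⟩
  apply val_injective
  rfl

/-- If the Hilbert function of `S ⧸ I` is eventually constant, then its value is the dimension of
the coordinate ring of a chart whose complement does not meet the zero locus. -/
lemma finrank_chart {I : Ideal (MvPolynomial (Fin (n + 1)) K)} (hlI : IsRegularMod I l)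
    (hl1 : l.IsHomogeneous 1)
    {k₀ t : ℕ} (ht : ∀ k, k₀ ≤ k → hilbertFunction I k = t) :
    Module.Finite K (AffineChart l ⧸ chartIdeal I l) ∧
      Module.finrank K (AffineChart l ⧸ chartIdeal I l) = t := by
  let ψ : ∀ k, homogeneousSubmodule (Fin (n + 1)) K k →ₗ[K] AffineChart l ⧸ chartIdeal I l :=
    fun k => (Ideal.Quotient.mkₐ K (chartIdeal I l)).toLinearMap ∘ₗ divPow hl1 k
  have hker : ∀ k, LinearMap.ker (ψ k) = (I.restrictScalars K).comap (Submodule.subtype _) := by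
    intro k
    ext a
    rw [LinearMap.mem_ker, Submodule.mem_comap]
    exact Ideal.Quotient.eq_zero_iff_mem.trans (mk_mem_chartIdeal hlI _)
  have hrank : ∀ k, Module.finrank K (LinearMap.range (ψ k)) = hilbertFunction I k := by
    intro k
    have h1 := LinearMap.finrank_range_add_finrank_ker (ψ k)
    have h2 := hilbertFunction_add_finrank I k
    rw [hker, ← Submodule.finrank_map_subtype_eq, Submodule.map_comap_subtype] at h1
    omega
  -- Since `a / l ^ k = a l / l ^ (k + 1)`, the ranges form an exhausting chain. Their dimensions
  -- are the values of the Hilbert function, so the chain stops at `k₀`.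
  have hmono : Monotone fun k => LinearMap.range (ψ k) := by
    refine monotone_nat_of_le_succ fun k => ?_
    rintro _ ⟨a, rfl⟩
    exact ⟨⟨a * l, IsHomogeneous.mul a.2 hl1⟩, by
      simp only [ψ, LinearMap.comp_apply, divPow_succ hl1 k a]⟩
  have hconst : ∀ k, k₀ ≤ k → LinearMap.range (ψ k₀) = LinearMap.range (ψ k) := fun k hk =>
    Submodule.eq_of_le_of_finrank_eq (hmono hk) (by rw [hrank, hrank, ht k hk, ht k₀ le_rfl])
  have htop : LinearMap.range (ψ k₀) = ⊤ := by
    rw [eq_top_iff]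
    intro x _
    obtain ⟨x, rfl⟩ := Ideal.Quotient.mk_surjective x
    obtain ⟨k, a, rfl⟩ := exists_divPow_eq hl1 x
    rw [hconst (max k k₀) (le_max_right _ _)]
    exact hmono (le_max_left k k₀) ⟨a, rfl⟩
  refine ⟨Module.Finite.of_surjective (ψ k₀) (LinearMap.range_eq_top.1 htop), ?_⟩
  rw [← ht k₀ le_rfl, ← hrank, htop, finrank_top]

end AwayAlgebra

/-! ### Tjurina algebras and the total Tjurina number -/

section Tjurina

variable {K : Type*} [Field K] {n : ℕ} {f : MvPolynomial (Fin (n + 1)) K} {d : ℕ}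

instance (p : Point K n) : p.asHomogeneousIdeal.toIdeal.IsPrime := p.isPrime

/-- The generators of the Tjurina ideal have numerator exactly `f` or a partial derivative. A
general element of `J_f` is reduced to these by taking homogeneous coefficients and dividing each
partial by `x_i ^ (d - 1)`, for a coordinate `x_i` not vanishing at `p`. -/
lemma mk_mem_tjurinaIdeal_of_mem_jacobianIdeal (hf : f.IsHomogeneous d) {p : Point K n}
    (c : NumDenSameDeg (homogeneousSubmodule (Fin (n + 1)) K)
      p.asHomogeneousIdeal.toIdeal.primeCompl)
    (hc : (c.num : MvPolynomial (Fin (n + 1)) K) ∈ jacobianIdeal f) :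
    HomogeneousLocalization.mk c ∈ tjurinaIdeal f p := by
  obtain ⟨k, num, den, hden⟩ := c
  obtain ⟨i, hi⟩ := not_irrelevantIdeal_le p
  obtain ⟨h, hh⟩ := Ideal.mem_span_range_iff_exists_fun.1 hc
  rcases lt_or_ge k (d - 1) with hk | hk
  · have h0 : (num : MvPolynomial (Fin (n + 1)) K) = 0 := by
      rw [← homogeneousComponent_eq_self num.2, ← hh, map_sum]
      refine Finset.sum_eq_zero fun j _ => ?_
      rw [mul_comm]
      exact homogeneousComponent_mul_of_lt hf.pderiv _ hk
    rw [mk_eq_zero_of_num _ (Subtype.ext h0)]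
    exact Ideal.zero_mem _
  · have hnum : (num : MvPolynomial (Fin (n + 1)) K) =
        ∑ j, pderiv j f * homogeneousComponent (k - (d - 1)) (h j) := by
      conv_lhs => rw [← homogeneousComponent_eq_self num.2, ← hh, map_sum]
      refine Finset.sum_congr rfl fun j _ => ?_
      rw [mul_comm]
      exact homogeneousComponent_mul_of_le hf.pderiv _ hk
    have hX : (X i : MvPolynomial (Fin (n + 1)) K) ^ (d - 1) ∉ p.asHomogeneousIdeal.toIdeal :=
      fun h => hi (p.isPrime.mem_of_pow_mem _ h)
    let u : Fin (n + 1) → LocalRing p := fun j => HomogeneousLocalization.mk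
      ⟨d - 1, ⟨pderiv j f, hf.pderiv⟩, ⟨X i ^ (d - 1), isHomogeneous_X_pow i _⟩, hX⟩
    let v : Fin (n + 1) → LocalRing p := fun j => HomogeneousLocalization.mk
      ⟨k, ⟨homogeneousComponent (k - (d - 1)) (h j) * X i ^ (d - 1), by
        have := (homogeneousComponent_isHomogeneous (k - (d - 1)) (h j)).mul
          (isHomogeneous_X_pow (R := K) i (d - 1))
        rwa [Nat.sub_add_cancel hk] at this⟩, den, hden⟩
    have hsum : HomogeneousLocalization.mk ⟨k, num, den, hden⟩ = ∑ j, v j * u j := by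
      apply val_injective
      rw [← HomogeneousLocalization.algebraMap_apply, ← HomogeneousLocalization.algebraMap_apply,
        map_sum, HomogeneousLocalization.algebraMap_apply, val_mk]
      simp only [hnum]
      rw [Localization.mk_sum]
      refine Finset.sum_congr rfl fun j _ => ?_
      rw [HomogeneousLocalization.algebraMap_apply, val_mul, val_mk, val_mk, Localization.mk_mul,
        Localization.mk_eq_mk_iff, Localization.r_iff_exists]
      refine ⟨1, ?_⟩
      simp only [OneMemClass.coe_one, one_mul, Submonoid.coe_mul]
      ring
    rw [hsum]
    refine Ideal.sum_mem _ fun j _ => Ideal.mul_mem_left _ _ (Ideal.subset_span ?_)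
    exact ⟨_, Or.inr ⟨j, rfl⟩, rfl⟩

/-- At a point of the chart `ℓ ≠ 0`, the Tjurina ideal is generated by the saturated ideal of the
singular scheme. -/
lemma tjurinaIdeal_eq_map [CharZero K] (hf : f.IsHomogeneous d) (hd : 0 < d)
    {I : Ideal (MvPolynomial (Fin (n + 1)) K)} (hJI : jacobianIdeal f ≤ I) {N : ℕ}
    (hN : ∀ z ∈ irrelevantIdeal K n ^ N, ∀ x ∈ I, z * x ∈ jacobianIdeal f)
    {l : MvPolynomial (Fin (n + 1)) K} (hlI : IsRegularMod I l) (hl1 : l.IsHomogeneous 1)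
    (p : Point K n) (hp : Submonoid.powers l ≤ p.asHomogeneousIdeal.toIdeal.primeCompl) :
    tjurinaIdeal f p =
      (chartIdeal I l).map (mapId (homogeneousSubmodule (Fin (n + 1)) K) hp) := by
  apply le_antisymm
  · refine Ideal.span_le.2 ?_
    rintro _ ⟨⟨k, num, den, hden⟩, hc, rfl⟩
    have hnumI : (num : MvPolynomial (Fin (n + 1)) K) ∈ I := by
      apply hJI
      rcases hc with h | ⟨j, h⟩
      · exact (congrArg (· ∈ jacobianIdeal f) h).mpr (mem_jacobianIdeal hf hd)
      · exact (congrArg (· ∈ jacobianIdeal f) h).mpr (Ideal.subset_span ⟨j, rfl⟩)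
    have hmem : divPow hl1 k num ∈ chartIdeal I l := (mk_mem_chartIdeal hlI _).2 hnumI
    have h1 := Ideal.mem_map_of_mem (mapId (homogeneousSubmodule (Fin (n + 1)) K) hp) hmem
    have h0 : mapId (homogeneousSubmodule (Fin (n + 1)) K) hp (divPow hl1 k num) =
        HomogeneousLocalization.mk
          ⟨k, num, ⟨l ^ k, isHomogeneous_pow_of_one hl1 k⟩, hp ⟨k, rfl⟩⟩ := rfl
    rw [h0] at h1
    -- The factor `l ^ k / den` replaces the denominator `l ^ k` by the given one.
    have h2 := Ideal.mul_mem_left _ (HomogeneousLocalization.mk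
      ⟨k, ⟨l ^ k, isHomogeneous_pow_of_one hl1 k⟩, den, hden⟩ : LocalRing p) h1
    rw [SetLike.mem_coe]
    convert h2 using 1
    apply val_injective
    rw [val_mul, val_mk, val_mk, val_mk, Localization.mk_mul,
      Localization.mk_eq_mk_iff, Localization.r_iff_exists]
    refine ⟨1, ?_⟩
    simp only [OneMemClass.coe_one, one_mul, Submonoid.coe_mul]
    ring
  · rw [Ideal.map_le_iff_le_comap]
    intro z hz
    obtain ⟨⟨k, num, den, hden⟩, rfl⟩ := HomogeneousLocalization.mk_surjective z
    rw [mk_mem_chartIdeal hlI] at hz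
    rw [Ideal.mem_comap]
    change HomogeneousLocalization.mk ⟨k, num, den, hp hden⟩ ∈ tjurinaIdeal f p
    -- Expanding the fraction by `x_i ^ N`, with `x_i` not vanishing at `p`, moves its numerator
    -- from `I` into `J_f`.
    obtain ⟨i, hi⟩ := not_irrelevantIdeal_le p
    have hX : (X i : MvPolynomial (Fin (n + 1)) K) ^ N ∉ p.asHomogeneousIdeal.toIdeal :=
      fun h => hi (p.isPrime.mem_of_pow_mem _ h)
    have h1 := mk_mem_tjurinaIdeal_of_mem_jacobianIdeal hf (p := p)
      ⟨N + k, ⟨X i ^ N * (num : MvPolynomial (Fin (n + 1)) K), (isHomogeneous_X_pow i N).mul num.2⟩,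
        ⟨X i ^ N * (den : MvPolynomial (Fin (n + 1)) K), (isHomogeneous_X_pow i N).mul den.2⟩,
        Submonoid.mul_mem _ hX (hp hden)⟩
      (hN (X i ^ N) (Ideal.pow_mem_pow (Ideal.subset_span (Set.mem_range_self i)) N) _ hz)
    convert h1 using 1
    apply val_injective
    rw [val_mk, val_mk, Localization.mk_eq_mk_iff, Localization.r_iff_exists]
    refine ⟨1, ?_⟩
    simp only [OneMemClass.coe_one, one_mul]
    ring

/-- An associated prime `(I : x)` containing all linear forms would give `x 𝔪 ⊆ I`, hence `x ∈ I` by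
saturatedness. -/
lemma exists_isRegularMod_linear [Infinite K] {I : Ideal (MvPolynomial (Fin (n + 1)) K)}
    (hsat : IsSaturatedBy (irrelevantIdeal K n) I) :
    ∃ l : MvPolynomial (Fin (n + 1)) K, l.IsHomogeneous 1 ∧ IsRegularMod I l := by
  obtain ⟨l, hl, h⟩ := exists_isRegularMod (fun _ : Unit => I)
    (homogeneousSubmodule (Fin (n + 1)) K 1) (by
      intro _ P hP x hx hPx hle
      refine hx (hsat x fun z hz => (hPx z).1 ?_)
      refine Ideal.span_le.2 ?_ hz
      rintro _ ⟨i, rfl⟩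
      exact hle (isHomogeneous_X K i))
  exact ⟨l, hl, h ()⟩

/-- Multiplication by `l` is injective on `S/I` between degrees of equal dimension, so `S/(I, l)`
vanishes in degree `k₀ + 1`. Then `(I, l)` contains powers of all the variables and has no zeros in
`ℙⁿ`. -/
lemma notMem_of_hilbertFunction_eventually_const {I : Ideal (MvPolynomial (Fin (n + 1)) K)}
    (hI : IsHomogeneousIdeal I) {l : MvPolynomial (Fin (n + 1)) K} (hl1 : l.IsHomogeneous 1)
    (hlI : IsRegularMod I l) {k₀ t : ℕ} (ht : ∀ k, k₀ ≤ k → hilbertFunction I k = t)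
    (p : Point K n) (hIp : I ≤ p.asHomogeneousIdeal.toIdeal) : l ∉ p.asHomogeneousIdeal := by
  intro hlp
  have h := congrArg (PowerSeries.coeff (k₀ + 1)) (hilbertSeries_eq_add hI hl1
    (Q' := I) fun x => ⟨hlI x, fun hx => Ideal.mul_mem_left _ _ hx⟩)
  rw [map_add, PowerSeries.coeff_X_pow_mul', if_pos (by omega), coeff_hilbertSeries,
    coeff_hilbertSeries, coeff_hilbertSeries, ht _ (by omega), ht _ (by omega)] at h
  have h0 : hilbertFunction (I ⊔ Ideal.span {l}) (k₀ + 1) = 0 := by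
    have : (hilbertFunction (I ⊔ Ideal.span {l}) (k₀ + 1) : ℤ) = 0 := by linarith
    exact_mod_cast this
  have h1 := hilbertFunction_add_finrank (I ⊔ Ideal.span {l}) (k₀ + 1)
  rw [h0, zero_add] at h1
  have h2 := Submodule.eq_of_le_of_finrank_eq inf_le_left h1
  obtain ⟨i, hi⟩ := not_irrelevantIdeal_le p
  have h3 : (X i : MvPolynomial (Fin (n + 1)) K) ^ (k₀ + 1) ∈ I ⊔ Ideal.span {l} := by
    have : (X i : MvPolynomial (Fin (n + 1)) K) ^ (k₀ + 1) ∈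
      homogeneousSubmodule (Fin (n + 1)) K (k₀ + 1) := isHomogeneous_X_pow i _
    rw [← h2] at this
    exact this.2
  have hle : I ⊔ Ideal.span {l} ≤ p.asHomogeneousIdeal.toIdeal :=
    sup_le hIp ((Ideal.span_singleton_le_iff_mem _).2 hlp)
  exact hi (p.isPrime.mem_of_pow_mem _ (hle h3))

open AlgebraicGeometry in
/-- The total Tjurina number is the eventual value of the Hilbert function of the saturation. -/
theorem totalTjurina_eq [CharZero K] (hf : f.IsHomogeneous d) (hd : 0 < d)
    {I : Ideal (MvPolynomial (Fin (n + 1)) K)} (hI : IsHomogeneousIdeal I)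
    (hsat : IsSaturatedBy (irrelevantIdeal K n) I) (hJI : jacobianIdeal f ≤ I) {N : ℕ}
    (hN : ∀ z ∈ irrelevantIdeal K n ^ N, ∀ x ∈ I, z * x ∈ jacobianIdeal f)
    {k₀ t : ℕ} (ht : ∀ k, k₀ ≤ k → hilbertFunction I k = t) :
    totalTjurina f = t := by
  have : Infinite K := Infinite.of_injective (Nat.cast : ℕ → K) Nat.cast_injective
  obtain ⟨l, hl1, hlI⟩ := exists_isRegularMod_linear hsat
  have hIp : ∀ p ∈ singularLocus f, I ≤ p.asHomogeneousIdeal.toIdeal := by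
    intro p hp x hx
    rw [mem_singularLocus_iff hf hd] at hp
    obtain ⟨i, hi⟩ := not_irrelevantIdeal_le p
    have := hp (hN (X i ^ N) (Ideal.pow_mem_pow (Ideal.subset_span (Set.mem_range_self i)) N) x hx)
    exact (p.isPrime.mem_or_mem this).resolve_left fun h => hi (p.isPrime.mem_of_pow_mem _ h)
  have hlp : ∀ p ∈ singularLocus f, l ∉ p.asHomogeneousIdeal := fun p hp =>
    notMem_of_hilbertFunction_eventually_const hI hl1 hlI ht p (hIp p hp)
  obtain ⟨hfin, hrank⟩ := finrank_chart hlI hl1 ht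
  let 𝒜 := homogeneousSubmodule (Fin (n + 1)) K
  let x : singularLocus f → ProjectiveSpectrum.basicOpen 𝒜 l := fun p => ⟨p.1, hlp p.1 p.2⟩
  let P : singularLocus f → Ideal (AffineChart l) := fun p =>
    ((ProjectiveSpectrum.Proj.toSpec 𝒜 l).base (x p)).asIdeal
  have hPprime : ∀ p, (P p).IsPrime := fun p =>
    ((ProjectiveSpectrum.Proj.toSpec 𝒜 l).base (x p)).isPrime
  have hmem : ∀ (p : singularLocus f) (z : NumDenSameDeg 𝒜 (.powers l)),
      HomogeneousLocalization.mk z ∈ P p ↔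
        (z.num : MvPolynomial (Fin (n + 1)) K) ∈ p.1.asHomogeneousIdeal := fun p z =>
    ProjectiveSpectrum.Proj.mk_mem_toSpec_base_apply 𝒜 (x p) z
  have hdiv : ∀ (p : singularLocus f) (k : ℕ) (a : 𝒜 k), divPow hl1 k a ∈ P p ↔
      (a : MvPolynomial (Fin (n + 1)) K) ∈ p.1.asHomogeneousIdeal := fun p k a => hmem p _
  have hbP : ∀ p, chartIdeal I l ≤ P p := by
    intro p z hz
    obtain ⟨z, rfl⟩ := HomogeneousLocalization.mk_surjective z
    rw [mk_mem_chartIdeal hlI] at hz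
    exact (hmem p z).2 (hIp p.1 p.2 hz)
  -- A homogeneous prime is determined by its forms, and a form `a` of degree `k` lies in `p`
  -- exactly when `a / l ^ k` lies in `P p`.
  have hinj : Function.Injective P := by
    intro p q hpq
    refine Subtype.ext (ProjectiveSpectrum.ext (HomogeneousIdeal.ext' ?_))
    intro k a ha
    rw [← hdiv p k ⟨a, ha⟩, ← hdiv q k ⟨a, ha⟩, hpq]
  have hsurj : ∀ Q : Ideal (AffineChart l), Q.IsPrime → chartIdeal I l ≤ Q → ∃ p, P p = Q := by
    intro Q hQ hIQ
    obtain ⟨y, hy⟩ := (ProjIsoSpecTopComponent.toSpec_bijective 𝒜 hl1 one_pos).2 ⟨Q, hQ⟩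
    have hyQ : ((ProjectiveSpectrum.Proj.toSpec 𝒜 l).base y).asIdeal = Q := by
      rw [ProjectiveSpectrum.Proj.toSpec_base_apply_eq, hy]
    have hyp : (y.1 : Point K n) ∈ singularLocus f := by
      refine (mem_singularLocus_iff hf hd _).2 (Ideal.span_le.2 ?_)
      rintro _ ⟨j, rfl⟩
      have h1 : divPow hl1 (d - 1) ⟨pderiv j f, hf.pderiv⟩ ∈ Q :=
        hIQ ((mk_mem_chartIdeal hlI _).2 (hJI (Ideal.subset_span ⟨j, rfl⟩)))
      rw [← hyQ] at h1
      exact (ProjectiveSpectrum.Proj.mk_mem_toSpec_base_apply 𝒜 y _).1 h1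
    exact ⟨⟨y.1, hyp⟩, hyQ⟩
  have hpow : ∀ p : singularLocus f,
      Submonoid.powers l ≤ p.1.asHomogeneousIdeal.toIdeal.primeCompl := fun p =>
    Submonoid.powers_le.2 (hlp p.1 p.2)
  let _ : ∀ p : singularLocus f, Algebra (AffineChart l) (LocalRing p.1) := fun p =>
    (mapId 𝒜 (hpow p)).toAlgebra
  have htower : ∀ p : singularLocus f, IsScalarTower K (AffineChart l) (LocalRing p.1) := fun p =>
    IsScalarTower.of_algebraMap_eq (R := K) (S := AffineChart l) (A := LocalRing p.1)
      fun _ => rfl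
  have hloc : ∀ p : singularLocus f, IsLocalization (P p).primeCompl (LocalRing p.1) := fun p =>
    ProjectiveSpectrum.Proj.isLocalization_atPrime 𝒜 l (x p) hl1 one_pos
  have h := tsum_length_quotient_map (K := K) (chartIdeal I l) P hbP hinj hsurj
    fun p => LocalRing p.1
  rw [hrank] at h
  rw [totalTjurina, ← h]
  refine tsum_congr fun p => ?_
  rw [localTjurina, tjurinaIdeal_eq_map hf hd hJI hN hlI hl1 p.1 (hpow p)]
  rfl

end Tjurina

/-! ### Positivity of the degrees in a homogeneous regular sequence -/

section RegularSequence

open RingTheory.Sequence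

/-- A form of degree `0` is a constant. A nonzero constant generates the unit ideal, and `0` is
regular only on the zero module; either way the quotient by the sequence would vanish. -/
lemma pos_of_isRegular {K σ : Type*} [Field K] {r : ℕ} {y : Fin r → MvPolynomial σ K}
    {a : Fin r → ℕ} (hy : ∀ i, (y i).IsHomogeneous (a i))
    (hreg : IsRegular (MvPolynomial σ K) (List.ofFn y)) (i : Fin r) : 0 < a i := by
  rw [Nat.pos_iff_ne_zero]
  intro hi
  have hyi := hy i
  rw [hi, ← totalDegree_zero_iff_isHomogeneous, totalDegree_eq_zero_iff_eq_C] at hyi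
  have htop : Ideal.ofList (List.ofFn y) ≠ ⊤ := fun h => hreg.top_ne_smul (by rw [h]; simp)
  by_cases hc : coeff 0 (y i) = 0
  · rw [hc, C_0] at hyi
    have h := hreg.regular_mod_prev i (by simp)
    rw [List.getElem_ofFn, Fin.eta, hyi, IsSMulRegular.zero_iff_subsingleton,
      Submodule.Quotient.subsingleton_iff, smul_eq_mul, Ideal.mul_top] at h
    refine htop (top_le_iff.1 (h ▸ Ideal.span_mono fun x hx => ?_))
    exact List.mem_of_mem_take hx
  · refine htop (Ideal.eq_top_of_isUnit_mem _ (x := y i)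
      (Ideal.subset_span (List.mem_ofFn.2 ⟨i, rfl⟩)) ?_)
    rw [hyi]
    exact (IsUnit.mk0 _ hc).map C

end RegularSequence

end ProjHypersurface

end

/-! ### The main theorem -/

open ProjHypersurface in
theorem corollary3p7 {K : Type*} [Field K] [CharZero K] (n d : ℕ) (hn : 2 ≤ n) (hd : 2 ≤ d)
    (f : MvPolynomial (Fin (n + 1)) K) (hf : f.IsHomogeneous d)
    -- `V : f = 0` has isolated singularities (and at least one)
    (hdim : ringKrullDim (MvPolynomial (Fin (n + 1)) K ⧸ jacobianIdeal f) = 1)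
    -- the singular scheme is a complete intersection of type `(a_1, …, a_n)`
    (a : Fin n → ℕ) (g : Fin n → MvPolynomial (Fin (n + 1)) K)
    (hg : ∀ i, (g i).IsHomogeneous (a i))
    (hreg : RingTheory.Sequence.IsRegular (MvPolynomial (Fin (n + 1)) K) (List.ofFn g))
    (hI : saturation (jacobianIdeal f) = Ideal.span (Set.range g)) :
    totalTjurina f = ((∏ i, a i : ℕ) : ℕ∞) ∧
    (∃ ct : ℕ, IsCoincidenceThreshold d f ct ∧
      (ct : ℤ) = ((n : ℤ) + 1) * ((d : ℤ) - 2) - ∑ i, (a i : ℤ) + n) ∧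
    (∃ st : ℕ, IsStabilityThreshold f st ∧
      (st : ℤ) = ((n : ℤ) + 1) * ((d : ℤ) - 2) + 1 - ((⨅ i, a i : ℕ) : ℤ)) ∧
    (∃ G F : Polynomial ℤ, IsHilbertNumerator (jacobianIdeal f) G ∧
      IsHilbertNumerator (saturation (jacobianIdeal f)) F ∧ F.natDegree ≤ G.natDegree) := by
  have hinf : Infinite K := Infinite.of_injective (Nat.cast : ℕ → K) Nat.cast_injective
  have ha0 := pos_of_isRegular hg hreg
  have hy := isPermRegular_of_isRegular hg ha0 hreg.toIsWeaklyRegular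
  have hsat := isSaturatedBy_saturation (jacobianIdeal f)
  have hJI := le_saturation (jacobianIdeal f)
  obtain ⟨N, hN⟩ := exists_pow_mul_mem_of_saturation_eq hI
  have hgmem : ∀ i, g i ∈ saturation (jacobianIdeal f) := fun i =>
    hI ▸ Ideal.subset_span ⟨i, rfl⟩
  have hIhom : IsHomogeneousIdeal (saturation (jacobianIdeal f)) := by
    rw [hI, ← Set.image_univ]
    exact isHomogeneousIdeal_span_image hg _
  obtain ⟨D, hD, hHJ⟩ := hilbertSeries_mul_of_saturation hy hg ha0 (hI ▸ hsat) (partialsSpan f)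
    (by simpa using finrank_partialsSpan_le f) (e := d - 1) (by omega)
    (fun v hv => isHomogeneous_of_mem_partialsSpan hf hv)
    (fun v hv => hI ▸ hJI (ideal_span_partialsSpan f ▸ Ideal.subset_span hv)) (N := N)
    (fun z hz i => ideal_span_partialsSpan f ▸ hN z hz _ (hgmem i))
  rw [ideal_span_partialsSpan] at hHJ
  have hHI := hy.hilbertSeries_mul hg
  rw [← hI] at hHI
  set J := jacobianIdeal f
  set e := d - 1 with he
  set G := almostCompleteIntersectionNumerator a e D with hGdef
  set F := completeIntersectionNumerator a with hFdef
  have hF : hilbertSeries (saturation J) * (1 - PowerSeries.X) = (F : PowerSeries ℤ) := by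
    apply mul_one_sub_X_eq_coe (r := n)
    have := one_sub_X_pow_mul_completeIntersectionNumerator a
    rw [Fintype.card_fin] at this
    rw [hHI, hFdef, this, coe_prod_one_sub_X_pow]
  have hG : hilbertSeries J * (1 - PowerSeries.X) = (G : PowerSeries ℤ) := by
    apply mul_one_sub_X_eq_coe (r := n)
    have := one_sub_X_pow_mul_almostCompleteIntersectionNumerator a e D
    rw [Fintype.card_fin] at this
    rw [hHJ, hGdef, this, Polynomial.coe_add, Polynomial.coe_mul, coe_prod_one_sub_X_pow]
    simp
  have hF1 := eval_one_completeIntersectionNumerator a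
  have hG1 := eval_one_almostCompleteIntersectionNumerator a e D
  have hprod : ((∏ i, a i : ℕ) : ℤ) ≠ 0 :=
    Nat.cast_ne_zero.2 (Finset.prod_ne_zero_iff.2 fun i _ => (ha0 i).ne')
  rw [Fintype.card_fin] at hD
  have : Nonempty (Fin n) := ⟨⟨0, by omega⟩⟩
  have hm : ∀ i, ⨅ i, a i ≤ a i := fun i => ciInf_le (OrderBot.bddBelow _) i
  have hm' : ∃ i, a i = ⨅ i, a i := ciInf_mem a
  have hm0 : 0 < ⨅ i, a i := by
    obtain ⟨i, hi⟩ := hm'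
    rw [← hi]
    exact ha0 i
  have hdegG := natDegree_almostCompleteIntersectionNumerator (e := e) (D := D) hm0
    (by rwa [Fintype.card_fin]) hm hm'
  rw [Fintype.card_fin, ← hGdef, add_mul, one_mul] at hdegG
  have htail : ∀ k, F.natDegree ≤ k → hilbertFunction (saturation J) k = ∏ i, a i := by
    intro k hk
    have := coeff_eq_eval_one_of_mul_one_sub_X hF hk
    rw [coeff_hilbertSeries, hF1] at this
    exact_mod_cast this
  have htau := totalTjurina_eq hf (by omega) hIhom hsat hJI hN htail
  refine ⟨htau, ⟨e + D - 1, ⟨exists_smooth hd, fun fs hfs hsm => ?_⟩, ?_⟩,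
    ⟨G.natDegree, ⟨fun k hk => ?_, fun p hp => ?_⟩, ?_⟩,
    ⟨G, F, ⟨hG, hG1.trans_ne hprod⟩, ⟨hF, hF1.trans_ne hprod⟩, ?_⟩⟩
  · have hHs := hilbertSeries_jacobianIdeal_of_smooth hfs hd hsm
    -- The two Milnor algebras differ by a copy of `S/I` shifted by `e + D`.
    have hsplit : hilbertSeries J =
        hilbertSeries (jacobianIdeal fs) + PowerSeries.X ^ (e + D) * hilbertSeries (saturation J) := by
      apply mul_right_cancel₀ (pow_ne_zero (n + 1) powerSeries_one_sub_X_ne_zero)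
      rw [hHJ, add_mul, hHs, mul_assoc, hHI, Fintype.card_fin]
    have hcoeff := fun k => congrArg (PowerSeries.coeff k) hsplit
    simp only [map_add, PowerSeries.coeff_X_pow_mul', coeff_hilbertSeries] at hcoeff
    constructor
    · intro k hk
      have := hcoeff k
      rw [if_neg (by omega), add_zero] at this
      exact_mod_cast this
    · intro q hq
      by_contra! hlt
      -- In degree `e + D` the difference is the value at `0` of the Hilbert function of `S/I`,
      -- which is `1` because all `a i` are positive.
      have h1 := hcoeff (e + D)
      rw [if_pos le_rfl, Nat.sub_self, hq (e + D) (by omega)] at h1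
      have h2 := congrArg PowerSeries.constantCoeff hHI
      have h3 : ∏ i, (1 - (0 : ℤ) ^ a i) = 1 :=
        Finset.prod_eq_one fun i _ => by rw [zero_pow (ha0 i).ne', sub_zero]
      rw [map_mul, map_prod, ← PowerSeries.coeff_zero_eq_constantCoeff_apply,
        coeff_hilbertSeries] at h2
      simp only [map_pow, map_sub, map_one, PowerSeries.constantCoeff_X, h3] at h2
      simp only [sub_zero, one_pow, mul_one] at h2
      omega
  · have hDz : (D : ℤ) + ∑ i, (a i : ℤ) = n * e := by exact_mod_cast hD
    have hez : (e : ℤ) = d - 1 := by omega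
    have h1 : ((e + D - 1 : ℕ) : ℤ) = e + D - 1 := by omega
    rw [h1]
    rw [hez] at hDz ⊢
    linear_combination hDz
  · have := coeff_eq_eval_one_of_mul_one_sub_X hG hk
    rw [coeff_hilbertSeries, hG1] at this
    rw [htau]
    exact_mod_cast this
  · by_contra! hlt
    -- Here `p < G.natDegree`, so the subtraction is genuine and degree `G.natDegree - 1` is in the
    -- range of `hp`; there the Hilbert function is still off by the leading coefficient of `G`.
    have h1 := hp (G.natDegree - 1) (by omega)
    refine coeff_ne_eval_one_of_mul_one_sub_X hG (k := G.natDegree - 1) (by omega) ?_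
    rw [htau] at h1
    rw [coeff_hilbertSeries, hG1]
    exact_mod_cast h1
  · have hez : (e : ℤ) = d - 1 := by omega
    have h1 : (G.natDegree : ℤ) + n + ((⨅ i, a i : ℕ) : ℤ) = n * e + e := by exact_mod_cast hdegG
    rw [hez] at h1
    linear_combination h1
  · have hF0 : F ≠ 0 := fun h => hprod (by rw [← hF1, ← hFdef, h, Polynomial.eval_zero])
    have h1 := natDegree_completeIntersectionNumerator_le a hF0
    rw [Fintype.card_fin, ← hFdef] at h1
    -- With `m` the minimum of the `a i`: `n m ≤ ∑ a i = n e - D` gives `m ≤ e`, hence `deg G = (n +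
    -- 1) e - n - m ≥ n e - n ≥ ∑ a i - n ≥ deg F`.
    have h2 : n * ⨅ i, a i ≤ ∑ i, a i := by
      have := Finset.sum_le_sum fun i (_ : i ∈ Finset.univ) => hm i
      simpa using this
    have h3 : ⨅ i, a i ≤ e := by
      by_contra! h
      have := Nat.mul_lt_mul_of_pos_left h (show 0 < n by omega)
      omega
    omega
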